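/- Let $d\ge 1$ and let $i\sim j$ denote nearest neighbours in $\mathbb Z^d$ ($\ell_1$-distance $1$). Put $\mathbb H^d_+=\{i\in\mathbb Z^d: i_d\ge 1\}$, $\Lambda_n=\{i\in\mathbb H^d_+: i_d\le n,\ |i_k|\le n \text{ for } k<d\}$, $\mathcal W_n=\{i\in\Lambda_n: i_d=1\}$, and let $\Delta_n$ be the union of $\Lambda_n$ and its image under the reflection $i_d\mapsto 1-i_d$. A sequence $\mathrm h=(\mathrm h_\ell)_{\ell\ge1}$ induces the field $\mathrm h_i=\mathrm h_{i_d}$ on $\mathbb H^d_+$. For $J>0$, $\lambda\ge 0$ let $$\mathcal Z^{\pm}_{n}=\sum_{\sigma}\exp\Big(\sum_{\substack{\{i,j\}\subset\mathbb H^d_+,\ i\sim j\\ \{i,j\}\cap\Lambda_n\ne\emptyset}}J\sigma_i\sigma_j+\sum_{i\in\Lambda_n}\mathrm h_i\sigma_i+\sum_{i\in\mathcal W_n}\lambda\sigma_i\Big),\qquad Q^{\pm}_n=\sum_\sigma\exp\Big(\sum_{\substack{\{i,j\}\subset\mathbb Z^d,\ i\sim j\\ \{i,j\}\cap\Delta_n\ne\emptyset}}J\sigma_i\sigma_j\Big),$$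 where the bond sums run over unordered pairs, and $\sigma$ runs over the $\{-1,1\}$-valued configurations that are equal to $\pm1$ off $\Lambda_n$, respectively off $\Delta_n$. Define the surface free energies and the wall free energy by $$F^{\pm}(J,\lambda,\mathrm h)=\lim_{n\to\infty}-\frac1{2|\mathcal W_n|}\ln\frac{(\mathcal Z^{\pm}_n)^2}{Q^{\pm}_n},\qquad \tau_w(J,\lambda,\mathrm h)=F^-(J,\lambda,\mathrm h)-F^+(J,\lambda,\mathrm h).$$ Then for all $J>0$, $\lambda\ge0$ and every summable sequence $\mathrm h$ of positive real numbers the two limits exist (and are finite), and: (a) $\tau_w(J,\lambda,\mathrm h)$ is non-decreasing in $J\in(0,\infty)$, and, for every $\ell\ge1$, non-decreasing in $\mathrm h_\ell\in(0,\infty)$, the other variables being fixed. (b) For every $J>0$ and $\delta>1$, the function $t\mapsto\tau_w\big(J,0,(t\,\ell^{-\delta})_{\ell\ge1}\big)$, that is, the wall free energy with the field $t/i_d^{\delta}$ and no additional wall term, is concave on $(0,\infty)$. -/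

import Mathlib

open Filter Topology Set

noncomputable section

namespace SemiInfIsing

/-- The lattice `ℤ^(m+1)`; every dimension at least one is of this form. -/
abbrev Site (m : ℕ) : Type := Fin (m + 1) → ℤ

/-- The last coordinate of a lattice site. -/
def height {m : ℕ} (i : Site m) : ℤ := i (Fin.last m)

/-- The nearest-neighbour graph: two sites are adjacent when their `ℓ¹`-distance is one. -/
def latticeGraph (m : ℕ) : SimpleGraph (Site m) where
  Adj i j := ∑ k, |i k - j k| = 1
  symm := ⟨fun i j h => by simpa only [abs_sub_comm] using h⟩
  loopless := ⟨fun i h => by simp at h⟩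

/-- The nearest-neighbour graph of the half-lattice `{i : 1 ≤ height i}`: no bond crosses
or lies below the wall (sites below the wall are isolated). -/
def halfGraph (m : ℕ) : SimpleGraph (Site m) where
  Adj i j := (latticeGraph m).Adj i j ∧ 1 ≤ height i ∧ 1 ≤ height j
  symm := ⟨fun _ _ h => ⟨h.1.symm, h.2.2, h.2.1⟩⟩
  loopless := ⟨fun i h => (latticeGraph m).loopless.irrefl i h.1⟩

theorem latticeGraph_neighborSet_finite (m : ℕ) (i : Site m) :
    ((latticeGraph m).neighborSet i).Finite := by
  refine (Set.finite_Icc (fun k => i k - 1) (fun k => i k + 1)).subset ?_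
  intro j hj
  have hj' : ∑ k, |i k - j k| = 1 := hj
  have hk : ∀ k, |i k - j k| ≤ 1 := fun k => by
    rw [← hj']
    exact Finset.single_le_sum (f := fun k => |i k - j k|)
      (fun _ _ => abs_nonneg _) (Finset.mem_univ k)
  exact ⟨fun k => by have := abs_le.1 (hk k); show i k - 1 ≤ j k; omega,
    fun k => by have := abs_le.1 (hk k); show j k ≤ i k + 1; omega⟩

theorem halfGraph_neighborSet_finite (m : ℕ) (i : Site m) :
    ((halfGraph m).neighborSet i).Finite :=
  (latticeGraph_neighborSet_finite m i).subset fun _ hj => hj.1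

instance (m : ℕ) : (latticeGraph m).LocallyFinite :=
  fun i => (latticeGraph_neighborSet_finite m i).fintype

instance (m : ℕ) : (halfGraph m).LocallyFinite :=
  fun i => (halfGraph_neighborSet_finite m i).fintype

/-- Spin configurations; a spin is an element `±1` of `ℤˣ`. -/
abbrev Config (m : ℕ) : Type := Site m → ℤˣ

/-- The spin at `i` as a real number. -/
def spin {m : ℕ} (σ : Config m) (i : Site m) : ℝ := ((σ i : ℤ) : ℝ)

/-- The (unordered) bonds of `G` with at least one endpoint in `Λ`. -/
def touchingBonds {m : ℕ} (G : SimpleGraph (Site m)) [G.LocallyFinite]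
    (Λ : Finset (Site m)) : Finset (Sym2 (Site m)) :=
  Λ.biUnion fun i => G.incidenceFinset i

/-- The interaction energy `∑ J σ_i σ_j`, over the bonds `{i, j}` of `G` that meet `Λ`. -/
def bondSum {m : ℕ} (G : SimpleGraph (Site m)) [G.LocallyFinite] (J : ℝ)
    (Λ : Finset (Site m)) (σ : Config m) : ℝ :=
  ∑ e ∈ touchingBonds G Λ, J * (e.map (spin σ)).mul

/-- The Hamiltonian of the Ising model on the whole lattice. -/
def isingHamiltonian {m : ℕ} (J : ℝ) (h : Site m → ℝ)
    (Λ : Finset (Site m)) (σ : Config m) : ℝ :=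
  -bondSum (latticeGraph m) J Λ σ - ∑ i ∈ Λ, h i * spin σ i

/-- The Hamiltonian of the semi-infinite Ising model with wall parameter `lam`
(to be used for `Λ` contained in the half-lattice). -/
def semiInfHamiltonian {m : ℕ} (J lam : ℝ) (h : Site m → ℝ)
    (Λ : Finset (Site m)) (σ : Config m) : ℝ :=
  -bondSum (halfGraph m) J Λ σ - ∑ i ∈ Λ, h i * spin σ i
    - ∑ i ∈ Λ with height i = 1, lam * spin σ i

/-- The configuration equal to `ω` on `Λ` and to `η` off `Λ`. As `ω` varies, this runs exactly
once through all configurations that agree with `η` off `Λ`. -/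
def glue {m : ℕ} (Λ : Finset (Site m)) (η : Config m) (ω : Λ → ℤˣ) : Config m :=
  fun i => if hi : i ∈ Λ then ω ⟨i, hi⟩ else η i

/-- The partition function `Q^η_{Λ; h}` of the Ising model. -/
def isingPartition {m : ℕ} (J : ℝ) (h : Site m → ℝ)
    (Λ : Finset (Site m)) (η : Config m) : ℝ :=
  ∑ ω : Λ → ℤˣ, Real.exp (-isingHamiltonian J h Λ (glue Λ η ω))

/-- The partition function `Z^η_{Λ; lam, h}` of the semi-infinite Ising model. -/
def semiInfPartition {m : ℕ} (J lam : ℝ) (h : Site m → ℝ)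
    (Λ : Finset (Site m)) (η : Config m) : ℝ :=
  ∑ ω : Λ → ℤˣ, Real.exp (-semiInfHamiltonian J lam h Λ (glue Λ η ω))

/-- The box `Λ_n = [-n, n]^m × [1, n]` of the half-lattice. -/
def box (m n : ℕ) : Finset (Site m) :=
  Finset.Icc (fun k => if k = Fin.last m then 1 else -(n : ℤ)) (fun _ => (n : ℤ))

/-- The reflection `i_d ↦ 1 - i_d` of the last coordinate. -/
def reflect {m : ℕ} (i : Site m) : Site m :=
  Function.update i (Fin.last m) (1 - height i)

/-- The extended box `Δ_n`, the union of `Λ_n` and its reflection. -/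
def extendedBox (m n : ℕ) : Finset (Site m) :=
  box m n ∪ (box m n).image reflect

/-- The part `W_n` of the wall in `Λ_n`. -/
def wall (m n : ℕ) : Finset (Site m) :=
  {i ∈ box m n | height i = 1}

/-- The external field induced by the sequence `(h_ℓ)_{ℓ ≥ 1}`: its value at `i` is `h_{i_d}`
for `i_d ≥ 1` (the values below the wall are never used). -/
def inducedField (m : ℕ) (h : ℕ+ → ℝ) : Site m → ℝ :=
  fun i => h (height i).toNat.toPNat'

/-- The finite-volume surface free energy
`-(1 / (2 |W_n|)) log ((Z^s_{Λ_n; lam, h})² / Q^s_{Δ_n; 0})`, where `s = ±1` is the constant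
boundary condition. -/
def finiteSurfaceFreeEnergy (m : ℕ) (s : ℤˣ) (J lam : ℝ) (h : ℕ+ → ℝ) (n : ℕ) : ℝ :=
  -(1 / (2 * ((wall m n).card : ℝ))) *
    Real.log ((semiInfPartition J lam (inducedField m h) (box m n) (fun _ => s)) ^ 2 /
      isingPartition J (fun _ => 0) (extendedBox m n) (fun _ => s))

/-- The surface free energy `F^s(J, lam, h)` for the boundary condition `s = ±1`. -/
def surfaceFreeEnergy (m : ℕ) (s : ℤˣ) (J lam : ℝ) (h : ℕ+ → ℝ) : ℝ :=
  limUnder atTop (finiteSurfaceFreeEnergy m s J lam h)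

/-- The wall free energy `τ_w(J, lam, h) = F^- - F^+`. -/
def wallFreeEnergy (m : ℕ) (J lam : ℝ) (h : ℕ+ → ℝ) : ℝ :=
  surfaceFreeEnergy m (-1) J lam h - surfaceFreeEnergy m 1 J lam h

/-- The sequence `ℓ ↦ t / ℓ^δ`. -/
def decayingSequence (δ t : ℝ) : ℕ+ → ℝ := fun ℓ => t / ((ℓ : ℕ) : ℝ) ^ δ

end SemiInfIsing

end

noncomputable section

namespace SemiInfIsing

/-! ### Positive cones of functions on finite product spaces -/

section Cones

variable {ι S Ω : Type*}

/-! Flipping all spins turns minus boundary conditions into plus ones with the opposite field. With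
`Z(f)` the half-lattice partition function with plus boundary and total field `f` (bulk and wall
terms), the finite-volume difference F⁻ - F⁺ is therefore log (Z(f) / Z(-f)) per wall site. Every
claim reduces to an inequality between products of such partition functions, followed by a limit.

The inequalities come from positivity of cones. If a semiring of functions has nonnegative sums and
contains 1/2, x + y and x - y, then ∑ exp y ≤ ∑ exp x (`sum_exp_le_sum_exp`). A product of two
partition functions is a sum over pairs (σ, στ). For fixed τ, the functions f(σ) ± f(στ) keep
nonnegative Fourier coefficients whenever f has them (`twist_mem_spinCone`, Ginibre's argument).
This gives monotonicity of Z(f) / Z(-f) in the coupling and in the field (`plusPartition_mul_le`).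
For concavity, four copies are rotated by a Hadamard matrix whose moments are nonnegative
(`emSign_moment_nonneg`, Ellis–Monroe). This yields midpoint concavity of log (Z(f) / Z(-f)) along
nonnegative fields (`plusPartition_midpoint_le`), and continuity upgrades it to concavity.

For existence of the limits, F⁺ splits into a pure part, comparing the full lattice with the lattice
cut along the wall, and a field part log (Z(f) / Z(0)); the difference F⁻ - F⁺ is the field part log
(Z(f) / Z(-f)). Each part is an explicit main term minus a "defect". Freezing spins to plus shows
that the defect increases with the volume (`log_ratio_le`). It is also additive over separated
volumes, invariant under horizontal translations, and at most a constant times the wall area, by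
summability of the field. A Fekete argument, tiling only along the wall, then gives a limit per wall
site (`exists_tendsto_div_card_wall`). -/

/-- The semiring of functions on `ι → S` generated by the nonnegative constants and the functions
of one coordinate that belong to the semiring `A`. -/
def productCone (ι : Type*) {S : Type*} (A : Subsemiring (S → ℝ)) : Subsemiring ((ι → S) → ℝ) :=
  Subsemiring.closure
    ({f | ∃ c : ℝ, 0 ≤ c ∧ f = fun _ => c} ∪ {f | ∃ i, ∃ g ∈ A, f = fun σ => g (σ i)})

theorem const_mem_productCone (A : Subsemiring (S → ℝ)) {c : ℝ} (hc : 0 ≤ c) :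
    (fun _ => c) ∈ productCone ι A :=
  Subsemiring.subset_closure (Or.inl ⟨c, hc, rfl⟩)

theorem coord_mem_productCone {A : Subsemiring (S → ℝ)} {g : S → ℝ} (hg : g ∈ A) (i : ι) :
    (fun σ => g (σ i)) ∈ productCone ι A :=
  Subsemiring.subset_closure (Or.inr ⟨i, g, hg, rfl⟩)

/-- Elements of the cone are sums of monomials c ∏ gᵢ(σᵢ) with gᵢ in `A`, since factors at the same
site multiply inside `A`. The sum of a monomial factorizes over sites. -/
theorem sum_nonneg_of_mem_productCone [Fintype ι] [Fintype S] [DecidableEq ι]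
    {A : Subsemiring (S → ℝ)}
    (hA : ∀ g ∈ A, 0 ≤ ∑ s, g s) {f : (ι → S) → ℝ} (hf : f ∈ productCone ι A) :
    0 ≤ ∑ σ, f σ := by
  rw [productCone, Subsemiring.mem_closure_iff] at hf
  induction hf using AddSubmonoid.closure_induction with
  | zero => simp
  | add x y _ _ hx hy => simpa [Finset.sum_add_distrib] using add_nonneg hx hy
  | mem x hx =>
    have key : ∃ c : ℝ, 0 ≤ c ∧ ∃ g : ι → S → ℝ, (∀ i, g i ∈ A) ∧
        x = fun σ => c * ∏ i, g i (σ i) := by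
      induction hx using Submonoid.closure_induction with
      | one => exact ⟨1, zero_le_one, fun _ => 1, fun _ => A.one_mem, by ext; simp⟩
      | mul x y _ _ hx hy =>
        obtain ⟨c, hc, g, hg, rfl⟩ := hx
        obtain ⟨d, hd, k, hk, rfl⟩ := hy
        refine ⟨c * d, mul_nonneg hc hd, fun i => g i * k i,
          fun i => A.mul_mem (hg i) (hk i), ?_⟩
        ext σ
        simp only [Pi.mul_apply, Finset.prod_mul_distrib]
        ring
      | mem x hx =>
        rcases hx with ⟨c, hc, rfl⟩ | ⟨i, g, hg, rfl⟩
        · exact ⟨c, hc, fun _ => 1, fun _ => A.one_mem, by ext; simp⟩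
        · refine ⟨1, zero_le_one, Function.update (fun _ => 1) i g, fun j => ?_, ?_⟩
          · by_cases h : j = i
            · subst h; simp [hg]
            · simp [Function.update_of_ne h]
          · ext σ
            rw [one_mul, Finset.prod_eq_single i]
            · simp
            · intro j _ hj; simp [Function.update_of_ne hj]
            · simp
    obtain ⟨c, hc, g, hg, rfl⟩ := key
    rw [← Finset.mul_sum]
    refine mul_nonneg hc ?_
    rw [← Fintype.prod_sum (fun i s => g i s)]
    exact Finset.prod_nonneg fun i _ => hA _ (hg i)

theorem hasSum_real_exp (x : ℝ) : HasSum (fun n : ℕ => x ^ n / n.factorial) (Real.exp x) := by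
  rw [Real.exp_eq_exp_ℝ]
  exact NormedSpace.expSeries_div_hasSum_exp x

/-- Expanding the exponential leaves the sums of g vⁿ, each an element of the cone. -/
theorem sum_mul_exp_nonneg [Fintype Ω] {C : Subsemiring (Ω → ℝ)}
    (hC : ∀ f ∈ C, 0 ≤ ∑ ω, f ω) {g v : Ω → ℝ} (hg : g ∈ C) (hv : v ∈ C) :
    0 ≤ ∑ ω, g ω * Real.exp (v ω) := by
  have h : HasSum (fun n : ℕ => ∑ ω, g ω * (v ω ^ n / n.factorial))
      (∑ ω, g ω * Real.exp (v ω)) :=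
    hasSum_sum fun ω _ => (hasSum_real_exp (v ω)).mul_left (g ω)
  refine h.nonneg fun n => ?_
  have h1 := hC _ (C.mul_mem hg (C.pow_mem hv n))
  have h2 : ∑ ω, g ω * (v ω ^ n / n.factorial) = (∑ ω, (g * v ^ n) ω) / n.factorial := by
    rw [Finset.sum_div]
    exact Finset.sum_congr rfl fun ω _ => by simp [mul_div_assoc]
  rw [h2]
  positivity

/-- The exponential series are compared term by term. The differences xⁿ - yⁿ stay in the cone
because 2(xⁿ⁺¹ ± yⁿ⁺¹) = (xⁿ ± yⁿ)(x + y) + (xⁿ ∓ yⁿ)(x - y), so both signs have to be carried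
through the induction. -/
theorem sum_exp_le_sum_exp [Fintype Ω] {C : Subsemiring (Ω → ℝ)}
    (hC : ∀ f ∈ C, 0 ≤ ∑ ω, f ω) (hhalf : (fun _ => (1 / 2 : ℝ)) ∈ C) {x y : Ω → ℝ}
    (hadd : x + y ∈ C) (hsub : x - y ∈ C) :
    ∑ ω, Real.exp (y ω) ≤ ∑ ω, Real.exp (x ω) := by
  have hpow : ∀ n : ℕ, x ^ n + y ^ n ∈ C ∧ x ^ n - y ^ n ∈ C := by
    intro n
    induction n with
    | zero => exact ⟨by simpa using C.add_mem C.one_mem C.one_mem, by simp⟩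
    | succ n ih =>
      constructor
      · convert! C.mul_mem hhalf (C.add_mem (C.mul_mem ih.1 hadd) (C.mul_mem ih.2 hsub)) using 1
        ext ω
        simp only [Pi.add_apply, Pi.sub_apply, Pi.mul_apply, Pi.pow_apply]
        ring
      · convert! C.mul_mem hhalf (C.add_mem (C.mul_mem ih.2 hadd) (C.mul_mem ih.1 hsub)) using 1
        ext ω
        simp only [Pi.add_apply, Pi.sub_apply, Pi.mul_apply, Pi.pow_apply]
        ring
  refine hasSum_le (fun n => ?_) (hasSum_sum fun ω _ => hasSum_real_exp (y ω))
    (hasSum_sum fun ω _ => hasSum_real_exp (x ω))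
  rw [← Finset.sum_div, ← Finset.sum_div]
  have h := hC _ (hpow n).2
  simp only [Pi.sub_apply, Pi.pow_apply, Finset.sum_sub_distrib] at h
  exact div_le_div_of_nonneg_right (by linarith) (by positivity)

/-! ### Functions of a single spin and of configurations -/

/-- The functions of one spin with nonnegative Fourier coefficients. -/
def spinSemiring : Subsemiring (ℤˣ → ℝ) where
  carrier := {f | |f (-1)| ≤ f 1}
  mul_mem' {f g} hf hg := by
    simp only [mem_ofPred_eq, Pi.mul_apply, abs_mul] at *
    exact mul_le_mul hf hg (abs_nonneg _) ((abs_nonneg _).trans hf)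
  one_mem' := by simp
  add_mem' {f g} hf hg := by
    simp only [mem_ofPred_eq, Pi.add_apply] at *
    exact (abs_add_le _ _).trans (add_le_add hf hg)
  zero_mem' := by simp

theorem mem_spinSemiring {f : ℤˣ → ℝ} : f ∈ spinSemiring ↔ |f (-1)| ≤ f 1 := Iff.rfl

theorem sum_spin (f : ℤˣ → ℝ) : ∑ s, f s = f 1 + f (-1) := by
  rw [show (Finset.univ : Finset ℤˣ) = {1, -1} from rfl, Finset.sum_pair (by decide)]

/-- The cone of functions on spin configurations with nonnegative Fourier coefficients. -/
abbrev spinCone (ι : Type*) : Subsemiring ((ι → ℤˣ) → ℝ) := productCone ι spinSemiring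

theorem sum_nonneg_of_mem_spinCone [Fintype ι] [DecidableEq ι] (f : (ι → ℤˣ) → ℝ)
    (hf : f ∈ spinCone ι) :
    0 ≤ ∑ σ, f σ := by
  refine sum_nonneg_of_mem_productCone (fun g hg => ?_) hf
  rw [sum_spin]
  have := neg_abs_le (g (-1))
  have := mem_spinSemiring.1 hg
  linarith

theorem coord_mem_spinCone (i : ι) : (fun σ : ι → ℤˣ => ((σ i : ℤ) : ℝ)) ∈ spinCone ι :=
  coord_mem_productCone (g := fun s : ℤˣ => ((s : ℤ) : ℝ)) (by simp [mem_spinSemiring]) i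

/-- Ginibre's positivity with the relative configuration τ held fixed. Products are handled by 2(fg
± f'g') = (f + f')(g ± g') + (f - f')(g ∓ g'). On one coordinate, the twist by -1 isolates the even
or the odd part of g, both of which have nonnegative coefficients. -/
theorem twist_mem_spinCone {f : (ι → ℤˣ) → ℝ} (hf : f ∈ spinCone ι) (τ : ι → ℤˣ) :
    (fun σ => f σ + f (σ * τ)) ∈ spinCone ι ∧ (fun σ => f σ - f (σ * τ)) ∈ spinCone ι := by
  have hhalf : (fun _ => (1 / 2 : ℝ)) ∈ spinCone ι := const_mem_productCone _ (by norm_num)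
  induction hf using Subsemiring.closure_induction with
  | zero =>
    constructor
    · exact const_mem_productCone _ (c := 0 + 0) (by norm_num)
    · exact const_mem_productCone _ (c := 0 - 0) (by norm_num)
  | one =>
    constructor
    · exact const_mem_productCone _ (c := 1 + 1) (by norm_num)
    · exact const_mem_productCone _ (c := 1 - 1) (by norm_num)
  | add f g _ _ hf hg =>
    constructor
    · convert! (spinCone ι).add_mem hf.1 hg.1 using 1
      ext σ; simp only [Pi.add_apply]; ring
    · convert! (spinCone ι).add_mem hf.2 hg.2 using 1
      ext σ; simp only [Pi.add_apply]; ring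
  | mul f g _ _ hf hg =>
    constructor
    · convert! (spinCone ι).mul_mem hhalf ((spinCone ι).add_mem
        ((spinCone ι).mul_mem hf.1 hg.1) ((spinCone ι).mul_mem hf.2 hg.2)) using 1
      ext σ; simp only [Pi.add_apply, Pi.mul_apply]; ring
    · convert! (spinCone ι).mul_mem hhalf ((spinCone ι).add_mem
        ((spinCone ι).mul_mem hf.1 hg.2) ((spinCone ι).mul_mem hf.2 hg.1)) using 1
      ext σ; simp only [Pi.add_apply, Pi.mul_apply]; ring
  | mem f hf =>
    rcases hf with ⟨c, hc, rfl⟩ | ⟨i, g, hg, rfl⟩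
    · constructor
      · exact const_mem_productCone _ (by positivity)
      · exact const_mem_productCone _ (by simp)
    · have h1 := (abs_le.1 (mem_spinSemiring.1 hg))
      constructor
      · refine coord_mem_productCone (g := fun s => g s + g (s * τ i)) ?_ i
        rw [mem_spinSemiring]
        rcases Int.units_eq_one_or (τ i) with h | h
        all_goals
          simp only [h]
          simp
          exact abs_le.2 ⟨by linarith, by linarith⟩
      · refine coord_mem_productCone (g := fun s => g s - g (s * τ i)) ?_ i
        rw [mem_spinSemiring]
        rcases Int.units_eq_one_or (τ i) with h | h
        · simp [h]
        · simp only [h]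
          simp
          exact abs_le.2 ⟨by linarith, by linarith⟩

/-- Summation over pairs of configurations, in terms of the first one and their quotient. -/
theorem sum_mul_sum_eq_sum_twist [Fintype ι] [DecidableEq ι] (F G : (ι → ℤˣ) → ℝ) :
    (∑ σ, F σ) * ∑ σ, G σ = ∑ τ : ι → ℤˣ, ∑ σ, F σ * G (σ * τ) := by
  rw [Finset.sum_mul_sum, Finset.sum_comm (s := (Finset.univ : Finset (ι → ℤˣ)))]
  rw [Finset.sum_comm]
  conv_rhs => rw [Finset.sum_comm]
  refine Finset.sum_congr rfl fun σ _ => ?_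
  exact (Equiv.sum_comp (Equiv.mulLeft σ) (fun ρ => F σ * G ρ)).symm

end Cones

/-! ### Four copies: the Ellis–Monroe positivity -/

section FourCopies

variable {ι : Type*}

/-- The combination of four copies of a spin with the signs `ε`. -/
def signedSum (ε : Fin 4 → ℝ) (s : Fin 4 → ℤˣ) : ℝ := ∑ a, ε a * ((s a : ℤ) : ℝ)

/-- The signs of the four Ellis–Monroe variables. -/
def emSign : Fin 4 → Fin 4 → ℝ :=
  ![![1, -1, 1, -1], ![-1, 1, 1, -1], ![1, 1, 1, 1], ![1, 1, -1, -1]]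

theorem sum_fin_four (f : (Fin 4 → ℤˣ) → ℝ) :
    ∑ s, f s = ∑ a, ∑ b, ∑ c, ∑ d, f ![a, b, c, d] := by
  let e : ℤˣ × ℤˣ × ℤˣ × ℤˣ ≃ (Fin 4 → ℤˣ) :=
    { toFun := fun p => ![p.1, p.2.1, p.2.2.1, p.2.2.2]
      invFun := fun s => (s 0, s 1, s 2, s 3)
      left_inv := fun p => rfl
      right_inv := fun s => by ext k; fin_cases k <;> rfl }
  rw [← Equiv.sum_comp e]
  simp only [Fintype.sum_prod_type]
  rfl

theorem emSign_moment_nonneg (k : Fin 4 → ℕ) :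
    0 ≤ ∑ s : Fin 4 → ℤˣ, ∏ v, signedSum (emSign v) s ^ k v := by
  rw [sum_fin_four]
  simp only [sum_spin, signedSum, emSign, Fin.prod_univ_four, Fin.sum_univ_four]
  simp only [Matrix.cons_val]
  norm_num
  have h0 : ∀ j : ℕ, (0 : ℝ) ≤ 0 ^ j := fun j => by positivity
  -- Of the sixteen configurations, eight make one variable ±4 and the others 0; they contribute in
  -- opposite pairs, hence nonnegatively. The other eight make all variables ±2, with every sign
  -- pattern of product +1; they cancel unless all exponents have the same parity, and then add up.
  -- The sign chosen for the second row of `emSign` is what makes this product +1 and not -1.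
  rcases Nat.even_or_odd (k 0) with h | h <;> rcases Nat.even_or_odd (k 1) with h' | h' <;>
    rcases Nat.even_or_odd (k 2) with h2 | h2 <;> rcases Nat.even_or_odd (k 3) with h3 | h3 <;>
    simp only [h.neg_pow, h'.neg_pow, h2.neg_pow, h3.neg_pow, neg_mul, mul_neg, neg_neg] <;>
    ring_nf <;> positivity

/-- The functions of four copies of a spin that are polynomials with nonnegative coefficients in
the Ellis–Monroe variables. -/
def emSemiring : Subsemiring ((Fin 4 → ℤˣ) → ℝ) :=
  Subsemiring.closure
    ({f | ∃ c : ℝ, 0 ≤ c ∧ f = fun _ => c} ∪ Set.range fun v => signedSum (emSign v))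

theorem sum_nonneg_of_mem_emSemiring (f : (Fin 4 → ℤˣ) → ℝ) (hf : f ∈ emSemiring) :
    0 ≤ ∑ s, f s := by
  rw [emSemiring, Subsemiring.mem_closure_iff] at hf
  induction hf using AddSubmonoid.closure_induction with
  | zero => simp
  | add x y _ _ hx hy => simpa [Finset.sum_add_distrib] using add_nonneg hx hy
  | mem x hx =>
    have key : ∃ c : ℝ, 0 ≤ c ∧ ∃ k : Fin 4 → ℕ,
        x = fun s => c * ∏ v, signedSum (emSign v) s ^ k v := by
      induction hx using Submonoid.closure_induction with
      | one => exact ⟨1, zero_le_one, 0, by ext; simp⟩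
      | mul x y _ _ hx hy =>
        obtain ⟨c, hc, k, rfl⟩ := hx
        obtain ⟨d, hd, l, rfl⟩ := hy
        refine ⟨c * d, mul_nonneg hc hd, k + l, ?_⟩
        ext s
        simp only [Pi.mul_apply, Pi.add_apply, pow_add, Finset.prod_mul_distrib]
        ring
      | mem x hx =>
        rcases hx with ⟨c, hc, rfl⟩ | ⟨v, rfl⟩
        · exact ⟨c, hc, 0, by ext; simp⟩
        · refine ⟨1, zero_le_one, Pi.single v 1, ?_⟩
          ext s
          rw [one_mul, Finset.prod_eq_single v]
          · simp
          · intro w _ hw; simp [Pi.single_eq_of_ne hw]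
          · simp
    obtain ⟨c, hc, k, rfl⟩ := key
    rw [← Finset.mul_sum]
    exact mul_nonneg hc (emSign_moment_nonneg k)

/-- The cone of functions on four copies of a spin configuration generated by the Ellis–Monroe
variables. -/
abbrev emCone (ι : Type*) : Subsemiring ((ι → Fin 4 → ℤˣ) → ℝ) := productCone ι emSemiring

theorem sum_nonneg_of_mem_emCone [Fintype ι] [DecidableEq ι] (f : (ι → Fin 4 → ℤˣ) → ℝ)
    (hf : f ∈ emCone ι) : 0 ≤ ∑ σ, f σ :=
  sum_nonneg_of_mem_productCone sum_nonneg_of_mem_emSemiring hf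

theorem signedSum_mem_emCone (v : Fin 4) (i : ι) :
    (fun σ : ι → Fin 4 → ℤˣ => signedSum (emSign v) (σ i)) ∈ emCone ι :=
  coord_mem_productCone (Subsemiring.subset_closure (Or.inr ⟨v, rfl⟩)) i

/-- A product of four sums over configurations as a sum over fourfold configurations. -/
theorem prod_sum_eq_sum_fourfold [Fintype ι] [DecidableEq ι] (F : Fin 4 → (ι → ℤˣ) → ℝ) :
    ∏ a, ∑ ω, F a ω = ∑ σ : ι → Fin 4 → ℤˣ, ∏ a, F a (fun i => σ i a) := by
  rw [Fintype.prod_sum]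
  exact (Equiv.sum_comp (Equiv.piComm fun (_ : ι) (_ : Fin 4) => ℤˣ)
    (fun ω => ∏ a, F a (ω a))).symm

end FourCopies

/-! ### Partition functions with plus boundary condition -/

section Partition

variable {m : ℕ}

/-- The configuration equal to `ω` on `Λ` and to `1` off `Λ`. -/
def plusGlue (Λ : Finset (Site m)) (ω : Λ → ℤˣ) : Config m := glue Λ (fun _ => 1) ω

/-- Minus the energy of `σ` in `Λ`, with coupling `J` on the bonds of `G` and field `f`. -/
def action (G : SimpleGraph (Site m)) [G.LocallyFinite] (J : ℝ) (Λ : Finset (Site m))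
    (f : Site m → ℝ) (σ : Config m) : ℝ :=
  bondSum G J Λ σ + ∑ i ∈ Λ, f i * spin σ i

/-- The partition function in `Λ` with plus boundary condition. -/
def plusPartition (G : SimpleGraph (Site m)) [G.LocallyFinite] (J : ℝ) (Λ : Finset (Site m))
    (f : Site m → ℝ) : ℝ :=
  ∑ ω : Λ → ℤˣ, Real.exp (action G J Λ f (plusGlue Λ ω))

theorem plusPartition_pos (G : SimpleGraph (Site m)) [G.LocallyFinite] (J : ℝ)
    (Λ : Finset (Site m)) (f : Site m → ℝ) : 0 < plusPartition G J Λ f :=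
  Finset.sum_pos (fun _ _ => Real.exp_pos _) Finset.univ_nonempty

theorem plusGlue_apply_mem {Λ : Finset (Site m)} (ω : Λ → ℤˣ) {i : Site m} (hi : i ∈ Λ) :
    plusGlue Λ ω i = ω ⟨i, hi⟩ := by simp [plusGlue, glue, hi]

theorem plusGlue_apply_not_mem {Λ : Finset (Site m)} (ω : Λ → ℤˣ) {i : Site m} (hi : i ∉ Λ) :
    plusGlue Λ ω i = 1 := by simp [plusGlue, glue, hi]

theorem glue_neg_one (Λ : Finset (Site m)) (ω : Λ → ℤˣ) :
    glue Λ (fun _ => -1) ω = -plusGlue Λ (-ω) := by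
  ext i
  by_cases hi : i ∈ Λ <;> simp [plusGlue, glue, hi]

theorem spin_neg (σ : Config m) (i : Site m) : spin (-σ) i = -spin σ i := by simp [spin]

theorem map_spin_mul (σ : Config m) (i j : Site m) :
    ((s(i, j) : Sym2 (Site m)).map (spin σ)).mul = spin σ i * spin σ j := rfl

theorem bondSum_neg (G : SimpleGraph (Site m)) [G.LocallyFinite] (J : ℝ) (Λ : Finset (Site m))
    (σ : Config m) : bondSum G J Λ (-σ) = bondSum G J Λ σ := by
  refine Finset.sum_congr rfl fun e _ => ?_
  induction e with
  | _ i j => simp [spin_neg]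

theorem action_neg_config (G : SimpleGraph (Site m)) [G.LocallyFinite] (J : ℝ)
    (Λ : Finset (Site m)) (f : Site m → ℝ) (σ : Config m) :
    action G J Λ f (-σ) = action G J Λ (-f) σ := by
  simp [action, bondSum_neg, spin_neg]

/-- The global spin flip preserves the bond energy and reverses the field. From here on only plus
boundary conditions are needed. -/
theorem sum_glue_neg_one (G : SimpleGraph (Site m)) [G.LocallyFinite] (J : ℝ)
    (Λ : Finset (Site m)) (f : Site m → ℝ) :
    ∑ ω : Λ → ℤˣ, Real.exp (action G J Λ f (glue Λ (fun _ => -1) ω)) =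
      plusPartition G J Λ (-f) := by
  simp only [glue_neg_one, action_neg_config]
  exact Equiv.sum_comp (Equiv.neg (Λ → ℤˣ))
    (fun ω => Real.exp (action G J Λ (-f) (plusGlue Λ ω)))

/-- The field of the semi-infinite model: the bulk field plus the wall term. -/
def totalField (lam : ℝ) (h : Site m → ℝ) (i : Site m) : ℝ :=
  h i + if height i = 1 then lam else 0

theorem neg_semiInfHamiltonian (J lam : ℝ) (h : Site m → ℝ) (Λ : Finset (Site m))
    (σ : Config m) :
    -semiInfHamiltonian J lam h Λ σ = action (halfGraph m) J Λ (totalField lam h) σ := by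
  simp only [semiInfHamiltonian, action, totalField, add_mul, Finset.sum_add_distrib,
    Finset.sum_filter, ite_mul, zero_mul]
  ring

theorem semiInfPartition_one (J lam : ℝ) (h : Site m → ℝ) (Λ : Finset (Site m)) :
    semiInfPartition J lam h Λ (fun _ => 1) =
      plusPartition (halfGraph m) J Λ (totalField lam h) := by
  simp only [semiInfPartition, neg_semiInfHamiltonian]; rfl

theorem semiInfPartition_neg_one (J lam : ℝ) (h : Site m → ℝ) (Λ : Finset (Site m)) :
    semiInfPartition J lam h Λ (fun _ => -1) =
      plusPartition (halfGraph m) J Λ (-totalField lam h) := by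
  simp only [semiInfPartition, neg_semiInfHamiltonian]
  exact sum_glue_neg_one _ _ _ _

theorem isingPartition_zero (J : ℝ) (Λ : Finset (Site m)) (s : ℤˣ) :
    isingPartition J (fun _ => 0) Λ (fun _ => s) = plusPartition (latticeGraph m) J Λ 0 := by
  have h : ∀ σ : Config m, -isingHamiltonian J (fun _ => 0) Λ σ =
      action (latticeGraph m) J Λ 0 σ := fun σ => by simp [isingHamiltonian, action]
  simp only [isingPartition, h]
  rcases Int.units_eq_one_or s with rfl | rfl
  · rfl
  · simpa using sum_glue_neg_one (latticeGraph m) J Λ 0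

theorem mem_touchingBonds {G : SimpleGraph (Site m)} [G.LocallyFinite] {Λ : Finset (Site m)}
    {i j : Site m} : s(i, j) ∈ touchingBonds G Λ ↔ G.Adj i j ∧ (i ∈ Λ ∨ j ∈ Λ) := by
  simp only [touchingBonds, Finset.mem_biUnion, SimpleGraph.mem_incidenceFinset,
    SimpleGraph.mk'_mem_incidenceSet_iff]
  constructor
  · rintro ⟨a, ha, h, rfl | rfl⟩ <;> simp [h, ha]
  · rintro ⟨h, hi | hj⟩
    · exact ⟨i, hi, h, Or.inl rfl⟩
    · exact ⟨j, hj, h, Or.inr rfl⟩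

/-! ### Membership in the cones -/

theorem sum_fun_mem {Ω κ : Type*} {C : Subsemiring (Ω → ℝ)} {s : Finset κ} {F : κ → Ω → ℝ}
    (h : ∀ e ∈ s, F e ∈ C) : (fun ω => ∑ e ∈ s, F e ω) ∈ C := by
  convert! C.sum_mem h using 1
  ext ω
  simp

/-- This is where the plus boundary matters: a frozen spin is the nonnegative constant 1. -/
theorem spin_mem_spinCone (Λ : Finset (Site m)) (i : Site m) :
    (fun ω => spin (plusGlue Λ ω) i) ∈ spinCone Λ := by
  by_cases hi : i ∈ Λ
  · simp only [spin, plusGlue_apply_mem _ hi]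
    exact coord_mem_spinCone _
  · simp only [spin, plusGlue_apply_not_mem _ hi]
    exact const_mem_productCone _ (by simp)

theorem bond_mem_spinCone (Λ : Finset (Site m)) (e : Sym2 (Site m)) :
    (fun ω => (e.map (spin (plusGlue Λ ω))).mul) ∈ spinCone Λ := by
  induction e with
  | _ i j => exact (spinCone Λ).mul_mem (spin_mem_spinCone Λ i) (spin_mem_spinCone Λ j)

theorem sum_bond_mem_spinCone {J : ℝ} (hJ : 0 ≤ J) (Λ : Finset (Site m))
    (s : Finset (Sym2 (Site m))) :
    (fun ω => ∑ e ∈ s, J * (e.map (spin (plusGlue Λ ω))).mul) ∈ spinCone Λ :=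
  sum_fun_mem fun e _ => (spinCone Λ).mul_mem (const_mem_productCone _ hJ) (bond_mem_spinCone Λ e)

theorem bondSum_mem_spinCone (G : SimpleGraph (Site m)) [G.LocallyFinite] {J : ℝ} (hJ : 0 ≤ J)
    (Λ Λ' : Finset (Site m)) : (fun ω => bondSum G J Λ' (plusGlue Λ ω)) ∈ spinCone Λ :=
  sum_bond_mem_spinCone hJ Λ _

theorem sum_field_mem_spinCone (Λ Λ' : Finset (Site m)) {f : Site m → ℝ}
    (hf : ∀ i ∈ Λ', 0 ≤ f i) :
    (fun ω => ∑ i ∈ Λ', f i * spin (plusGlue Λ ω) i) ∈ spinCone Λ :=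
  sum_fun_mem fun i hi =>
    (spinCone Λ).mul_mem (const_mem_productCone _ (hf i hi)) (spin_mem_spinCone Λ i)

theorem signedSum_glue_mem_emCone (Λ : Finset (Site m)) (v : Fin 4) (i : Site m) :
    (fun σ : Λ → Fin 4 → ℤˣ =>
      ∑ a, emSign v a * spin (plusGlue Λ fun j => σ j a) i) ∈ emCone Λ := by
  by_cases hi : i ∈ Λ
  · simp only [spin, plusGlue_apply_mem _ hi]
    exact signedSum_mem_emCone v _
  · simp only [spin, plusGlue_apply_not_mem _ hi]
    refine const_mem_productCone _ ?_
    -- A frozen site contributes the row sum of `emSign`, namely 0, 0, 4, 0 for the four rows.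
    simp only [Units.val_one, Int.cast_one, mul_one, Fin.sum_univ_four]
    obtain rfl | rfl | rfl | rfl : v = 0 ∨ v = 1 ∨ v = 2 ∨ v = 3 := by omega
    all_goals simp only [emSign, Matrix.cons_val]; norm_num

/-! ### Correlation inequalities in finite volume -/

/-- The source of both monotonicity statements. Put s = σ, s' = στ, write b, b' for their bond sums
at unit coupling, and let x, y be the exponents on the right and on the left. Then x + y = (J₁ +
J₂)(b + b') + ∑ (f₁ + f₂)(s - s') and x - y = (J₂ - J₁)(b - b') + ∑ (f₂ - f₁)(s + s'), which are
twists with nonnegative coefficients. -/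
theorem plusPartition_mul_le (G : SimpleGraph (Site m)) [G.LocallyFinite] {J₁ J₂ : ℝ}
    (hJ₁ : 0 ≤ J₁) (hJ : J₁ ≤ J₂) (Λ : Finset (Site m)) {f₁ f₂ : Site m → ℝ}
    (hf₁ : ∀ i ∈ Λ, 0 ≤ f₁ i) (hf : ∀ i ∈ Λ, f₁ i ≤ f₂ i) :
    plusPartition G J₁ Λ f₁ * plusPartition G J₂ Λ (-f₂) ≤
      plusPartition G J₂ Λ f₂ * plusPartition G J₁ Λ (-f₁) := by
  simp only [plusPartition]
  rw [sum_mul_sum_eq_sum_twist, sum_mul_sum_eq_sum_twist]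
  refine Finset.sum_le_sum fun τ _ => ?_
  simp only [← Real.exp_add]
  have hbs := twist_mem_spinCone (bondSum_mem_spinCone G (add_nonneg hJ₁ (hJ₁.trans hJ)) Λ Λ) τ
  have hbd := twist_mem_spinCone (bondSum_mem_spinCone G (sub_nonneg.2 hJ) Λ Λ) τ
  have hfs := twist_mem_spinCone (sum_field_mem_spinCone Λ Λ (f := f₁ + f₂)
    fun i hi => add_nonneg (hf₁ i hi) ((hf₁ i hi).trans (hf i hi))) τ
  have hfd := twist_mem_spinCone (sum_field_mem_spinCone Λ Λ (f := f₂ - f₁)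
    fun i hi => sub_nonneg.2 (hf i hi)) τ
  refine sum_exp_le_sum_exp (C := spinCone Λ)
    (x := fun ω => action G J₂ Λ f₂ (plusGlue Λ ω) + action G J₁ Λ (-f₁) (plusGlue Λ (ω * τ)))
    (y := fun ω => action G J₁ Λ f₁ (plusGlue Λ ω) + action G J₂ Λ (-f₂) (plusGlue Λ (ω * τ)))
    sum_nonneg_of_mem_spinCone
    (const_mem_productCone _ (by norm_num)) ?_ ?_
  · convert! (spinCone Λ).add_mem hbs.1 hfs.2 using 1
    ext ω
    simp only [action, bondSum, Pi.add_apply, Pi.neg_apply, add_mul, neg_mul,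
      Finset.sum_add_distrib, Finset.sum_neg_distrib]
    ring
  · convert! (spinCone Λ).add_mem hbd.2 hfd.1 using 1
    ext ω
    simp only [action, bondSum, Pi.add_apply, Pi.sub_apply, Pi.neg_apply, sub_mul, neg_mul,
      Finset.sum_sub_distrib, Finset.sum_neg_distrib]
    ring

theorem prod_plusPartition (G : SimpleGraph (Site m)) [G.LocallyFinite] (J : ℝ)
    (Λ : Finset (Site m)) (φ : Fin 4 → Site m → ℝ) :
    ∏ a, plusPartition G J Λ (φ a) =
      ∑ σ : Λ → Fin 4 → ℤˣ, Real.exp (∑ a, action G J Λ (φ a) (plusGlue Λ fun i => σ i a)) := by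
  simp only [plusPartition, Real.exp_sum]
  exact prod_sum_eq_sum_fourfold fun a ω => Real.exp (action G J Λ (φ a) (plusGlue Λ ω))

/-- Half of the sign matrix is orthogonal, so the interaction summed over four copies is one quarter
of the interaction summed over the four rotated variables. -/
theorem sum_bondSum_mem_emCone (G : SimpleGraph (Site m)) [G.LocallyFinite] {J : ℝ} (hJ : 0 ≤ J)
    (Λ : Finset (Site m)) :
    (fun σ : Λ → Fin 4 → ℤˣ => ∑ a, bondSum G J Λ (plusGlue Λ fun i => σ i a)) ∈ emCone Λ := by
  simp only [bondSum]
  have h : ∀ e ∈ touchingBonds G Λ, (fun σ : Λ → Fin 4 → ℤˣ =>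
      ∑ a, J * (e.map (spin (plusGlue Λ fun i => σ i a))).mul) ∈ emCone Λ := by
    intro e _
    induction e with
    | _ i j =>
      have h' : (fun σ : Λ → Fin 4 → ℤˣ => ∑ v, J / 4 *
          ((∑ a, emSign v a * spin (plusGlue Λ fun j => σ j a) i) *
            ∑ a, emSign v a * spin (plusGlue Λ fun j => σ j a) j)) ∈ emCone Λ :=
        sum_fun_mem fun v _ => (emCone Λ).mul_mem (const_mem_productCone _ (by positivity))
          ((emCone Λ).mul_mem (signedSum_glue_mem_emCone Λ v i) (signedSum_glue_mem_emCone Λ v j))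
      convert! h' using 1
      ext σ
      simp only [map_spin_mul, Fin.sum_univ_four, emSign, Matrix.cons_val]
      ring
  convert! sum_fun_mem h using 1
  ext σ
  rw [Finset.sum_comm]

/-- After taking logarithms this is midpoint concavity of f ↦ log (Z(f) / Z(-f)) between f - r and f
+ r. The four fields on the two sides add up to 2f(1, 1, -1, -1) + r(1, -1, 1, -1) and differ by
r(-1, 1, 1, -1): nonnegative combinations of rows of `emSign`. The bonds cancel in the difference.
-/
theorem plusPartition_midpoint_le (G : SimpleGraph (Site m)) [G.LocallyFinite] {J : ℝ}
    (hJ : 0 ≤ J) (Λ : Finset (Site m)) {f r : Site m → ℝ}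
    (hf : ∀ i ∈ Λ, 0 ≤ f i) (hr : ∀ i ∈ Λ, 0 ≤ r i) :
    plusPartition G J Λ (f + r) * plusPartition G J Λ (f - r) * plusPartition G J Λ (-f) ^ 2 ≤
      plusPartition G J Λ f ^ 2 * plusPartition G J Λ (-(f - r)) * plusPartition G J Λ (-(f + r))
      := by
  have hl := prod_plusPartition G J Λ ![f + r, f - r, -f, -f]
  have hr' := prod_plusPartition G J Λ ![f, f, -(f - r), -(f + r)]
  simp only [Fin.prod_univ_four, Matrix.cons_val] at hl hr'
  rw [show plusPartition G J Λ (f + r) * plusPartition G J Λ (f - r) *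
      plusPartition G J Λ (-f) ^ 2 = _ from (by ring : _ = _ * _ * _ * _).trans hl,
    show plusPartition G J Λ f ^ 2 * plusPartition G J Λ (-(f - r)) *
      plusPartition G J Λ (-(f + r)) = _ from (by ring : _ = _ * _ * _ * _).trans hr']
  have hfield : ∀ (v : Fin 4) (g : Site m → ℝ), (∀ i ∈ Λ, 0 ≤ g i) →
      (fun σ : Λ → Fin 4 → ℤˣ => ∑ i ∈ Λ, g i *
        ∑ a, emSign v a * spin (plusGlue Λ fun j => σ j a) i) ∈ emCone Λ := fun v g hg =>
    sum_fun_mem fun i hi =>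
      (emCone Λ).mul_mem (const_mem_productCone _ (hg i hi)) (signedSum_glue_mem_emCone Λ v i)
  have hb := sum_bondSum_mem_emCone G hJ Λ
  refine sum_exp_le_sum_exp (C := emCone Λ) sum_nonneg_of_mem_emCone
    (x := fun σ => ∑ a, action G J Λ (![f, f, -(f - r), -(f + r)] a) (plusGlue Λ fun i => σ i a))
    (y := fun σ => ∑ a, action G J Λ (![f + r, f - r, -f, -f] a) (plusGlue Λ fun i => σ i a))
    (const_mem_productCone _ (by norm_num)) ?_ ?_
  · convert! (emCone Λ).add_mem ((emCone Λ).add_mem (hfield 3 f hf) (hfield 3 f hf))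
      ((emCone Λ).add_mem (hfield 0 r hr) ((emCone Λ).add_mem hb hb)) using 1
    ext σ
    simp only [action, Pi.add_apply, Pi.sub_apply, Pi.neg_apply, Fin.sum_univ_four, emSign,
      Matrix.cons_val, mul_add, add_mul, sub_mul, neg_mul, mul_neg, one_mul, neg_sub,
      Finset.sum_sub_distrib, Finset.sum_add_distrib, Finset.sum_neg_distrib]
    ring
  · convert! hfield 1 r hr using 1
    ext σ
    simp only [action, Pi.add_apply, Pi.sub_apply, Pi.neg_apply, Fin.sum_univ_four, emSign,
      Matrix.cons_val, mul_add, add_mul, sub_mul, neg_mul, mul_neg, one_mul, neg_sub,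
      Finset.sum_sub_distrib, Finset.sum_add_distrib, Finset.sum_neg_distrib]
    ring

end Partition

/-! ### Freezing, factorization and invariance of the partition functions -/

section Volume

variable {m : ℕ}

theorem spin_of_eq_one {σ : Config m} {i : Site m} (h : σ i = 1) : spin σ i = 1 := by
  simp [spin, h]

/-- Summation over the spins in `Λ₀`, as a sum over the spins in `Λ`. -/
theorem sum_frozen {Λ₀ Λ : Finset (Site m)} (h : Λ₀ ⊆ Λ) (F : Config m → ℝ) :
    ∑ ω : Λ → ℤˣ, (∏ i ∈ Λ \ Λ₀, (1 + spin (plusGlue Λ ω) i) / 2) * F (plusGlue Λ ω) =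
      ∑ ω : Λ₀ → ℤˣ, F (plusGlue Λ₀ ω) := by
  symm
  have hglue : ∀ ω : Λ₀ → ℤˣ, plusGlue Λ (fun i => plusGlue Λ₀ ω i) = plusGlue Λ₀ ω := by
    intro ω
    funext i
    by_cases hi : i ∈ Λ
    · rw [plusGlue_apply_mem _ hi]
    · rw [plusGlue_apply_not_mem _ hi, plusGlue_apply_not_mem _ fun h' => hi (h h')]
  refine Finset.sum_of_injOn (fun ω i => plusGlue Λ₀ ω i) ?_ (by simp [Set.MapsTo]) ?_ ?_
  · intro ω _ ω' _ he
    funext i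
    have := congrFun he ⟨i, h i.2⟩
    simpa only [plusGlue_apply_mem _ i.2] using this
  · intro ω _ hω
    by_cases h1 : ∀ i ∈ Λ \ Λ₀, spin (plusGlue Λ ω) i = 1
    · refine absurd ⟨fun i => ω ⟨i, h i.2⟩, by simp, ?_⟩ hω
      funext i
      beta_reduce
      by_cases hi : (i : Site m) ∈ Λ₀
      · rw [plusGlue_apply_mem _ hi]
      · rw [plusGlue_apply_not_mem _ hi]
        have h2 := h1 i (Finset.mem_sdiff.2 ⟨i.2, hi⟩)
        rw [spin, plusGlue_apply_mem _ i.2] at h2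
        have h3 : ((ω ⟨i, i.2⟩ : ℤˣ) : ℤ) = 1 := by exact_mod_cast h2
        exact (Units.ext h3).symm
    · push Not at h1
      obtain ⟨i, hi, h2⟩ := h1
      rw [Finset.prod_eq_zero hi, zero_mul]
      rcases Int.units_eq_one_or (plusGlue Λ ω i) with h3 | h3
      · exact absurd (spin_of_eq_one h3) h2
      · simp [spin, h3]
  · intro ω _
    rw [hglue, Finset.prod_eq_one, one_mul]
    intro i hi
    rw [spin_of_eq_one (plusGlue_apply_not_mem _ (Finset.mem_sdiff.1 hi).2)]
    norm_num

/-- Freezing the spins of `Λ` off `Λ₀` to be plus increases the ratio of two partition functions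
whose product is ferromagnetic after any relative twist. -/
theorem log_ratio_le {Λ₀ Λ : Finset (Site m)} (h : Λ₀ ⊆ Λ) {u w u₀ w₀ : Config m → ℝ} {a b : ℝ}
    (hu : ∀ σ : Config m, (∀ i ∉ Λ₀, σ i = 1) → u σ = u₀ σ + a)
    (hw : ∀ σ : Config m, (∀ i ∉ Λ₀, σ i = 1) → w σ = w₀ σ + b)
    (hmem : ∀ τ, (fun ω => u (plusGlue Λ ω) + w (plusGlue Λ (ω * τ))) ∈ spinCone Λ) :
    Real.log (∑ ω : Λ → ℤˣ, Real.exp (u (plusGlue Λ ω))) -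
        Real.log (∑ ω : Λ → ℤˣ, Real.exp (w (plusGlue Λ ω))) ≤
      Real.log (∑ ω : Λ₀ → ℤˣ, Real.exp (u₀ (plusGlue Λ₀ ω))) -
        Real.log (∑ ω : Λ₀ → ℤˣ, Real.exp (w₀ (plusGlue Λ₀ ω))) + (a - b) := by
  have hpos : ∀ (Λ : Finset (Site m)) (v : Config m → ℝ),
      0 < ∑ ω : Λ → ℤˣ, Real.exp (v (plusGlue Λ ω)) := fun _ _ =>
    Finset.sum_pos (fun _ _ => Real.exp_pos _) Finset.univ_nonempty
  -- The indicator that all spins of Λ off Λ₀ are plus; expanded, it has nonnegative Fourier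
  -- coefficients.
  set P : (Λ → ℤˣ) → ℝ := fun ω => ∏ i ∈ Λ \ Λ₀, (1 + spin (plusGlue Λ ω) i) / 2 with hP
  have hPmem : P ∈ spinCone Λ := by
    have : ∏ i ∈ Λ \ Λ₀, ((fun _ => (1 / 2 : ℝ)) * ((fun _ => (1 : ℝ)) +
        fun ω : Λ → ℤˣ => spin (plusGlue Λ ω) i)) ∈ spinCone Λ :=
      (spinCone Λ).prod_mem fun i _ => (spinCone Λ).mul_mem
        (const_mem_productCone _ (by norm_num)) ((spinCone Λ).add_mem
          (const_mem_productCone _ zero_le_one) (spin_mem_spinCone Λ i))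
    convert! this using 1
    ext ω
    simp only [hP, Finset.prod_apply, Pi.mul_apply, Pi.add_apply]
    exact Finset.prod_congr rfl fun i _ => by ring
  have hfrozen : ∀ {v v₀ : Config m → ℝ} {c : ℝ},
      (∀ σ : Config m, (∀ i ∉ Λ₀, σ i = 1) → v σ = v₀ σ + c) →
      ∑ ω, P ω * Real.exp (v (plusGlue Λ ω)) =
        (∑ ω : Λ₀ → ℤˣ, Real.exp (v₀ (plusGlue Λ₀ ω))) * Real.exp c := by
    intro v v₀ c hv
    rw [sum_frozen h fun σ => Real.exp (v σ), Finset.sum_mul]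
    refine Finset.sum_congr rfl fun ω _ => ?_
    rw [hv _ fun i hi => plusGlue_apply_not_mem ω hi, Real.exp_add]
  -- The frozen event is more likely under the weight exp u than under exp w: for each τ the
  -- difference of the two sides is ∑ (P(σ) - P(στ)) exp (u(σ) + w(στ)), which is nonnegative.
  have key : (∑ ω, Real.exp (u (plusGlue Λ ω))) * ∑ ω, P ω * Real.exp (w (plusGlue Λ ω)) ≤
      (∑ ω, P ω * Real.exp (u (plusGlue Λ ω))) * ∑ ω, Real.exp (w (plusGlue Λ ω)) := by
    rw [sum_mul_sum_eq_sum_twist, sum_mul_sum_eq_sum_twist]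
    refine Finset.sum_le_sum fun τ _ => ?_
    have := sum_mul_exp_nonneg sum_nonneg_of_mem_spinCone (twist_mem_spinCone hPmem τ).2 (hmem τ)
    rw [← sub_nonneg, ← Finset.sum_sub_distrib]
    convert! this using 1
    refine Finset.sum_congr rfl fun ω _ => ?_
    rw [Real.exp_add]
    ring
  rw [hfrozen hu, hfrozen hw] at key
  have h1 := Real.log_le_log (mul_pos (hpos _ _) (mul_pos (hpos _ _) (Real.exp_pos _))) key
  rw [Real.log_mul (hpos _ _).ne' (mul_pos (hpos _ _) (Real.exp_pos _)).ne',
    Real.log_mul (hpos _ _).ne' (Real.exp_pos _).ne',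
    Real.log_mul (mul_pos (hpos _ _) (Real.exp_pos _)).ne' (hpos _ _).ne',
    Real.log_mul (hpos _ _).ne' (Real.exp_pos _).ne', Real.log_exp, Real.log_exp] at h1
  linarith

theorem touchingBonds_mono (G : SimpleGraph (Site m)) [G.LocallyFinite] {Λ₀ Λ : Finset (Site m)}
    (h : Λ₀ ⊆ Λ) : touchingBonds G Λ₀ ⊆ touchingBonds G Λ :=
  Finset.biUnion_subset_biUnion_of_subset_left _ h

theorem bondSum_eq_of_frozen (G : SimpleGraph (Site m)) [G.LocallyFinite] (J : ℝ)
    {Λ₀ Λ : Finset (Site m)} (h : Λ₀ ⊆ Λ) {σ : Config m} (hσ : ∀ i ∉ Λ₀, σ i = 1) :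
    bondSum G J Λ σ = bondSum G J Λ₀ σ + (bondSum G J Λ 1 - bondSum G J Λ₀ 1) := by
  simp only [bondSum]
  rw [← Finset.sum_sdiff (touchingBonds_mono G h),
    ← Finset.sum_sdiff (touchingBonds_mono G h) (f := fun e => J * (e.map (spin 1)).mul)]
  have : ∑ e ∈ touchingBonds G Λ \ touchingBonds G Λ₀, J * (e.map (spin σ)).mul =
      ∑ e ∈ touchingBonds G Λ \ touchingBonds G Λ₀, J * (e.map (spin 1)).mul := by
    refine Finset.sum_congr rfl fun e he => ?_
    induction e with
    | _ i j =>
      rw [Finset.mem_sdiff, mem_touchingBonds, mem_touchingBonds] at he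
      have hi : i ∉ Λ₀ := fun hi => he.2 ⟨he.1.1, Or.inl hi⟩
      have hj : j ∉ Λ₀ := fun hj => he.2 ⟨he.1.1, Or.inr hj⟩
      rw [map_spin_mul, map_spin_mul, spin_of_eq_one (hσ i hi), spin_of_eq_one (hσ j hj),
        spin_of_eq_one (Pi.one_apply i), spin_of_eq_one (Pi.one_apply j)]
  linarith

theorem action_eq_of_frozen (G : SimpleGraph (Site m)) [G.LocallyFinite] (J : ℝ)
    {Λ₀ Λ : Finset (Site m)} (h : Λ₀ ⊆ Λ) (f : Site m → ℝ) {σ : Config m}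
    (hσ : ∀ i ∉ Λ₀, σ i = 1) :
    action G J Λ f σ = action G J Λ₀ f σ +
      (bondSum G J Λ 1 - bondSum G J Λ₀ 1 + ∑ i ∈ Λ \ Λ₀, f i) := by
  rw [action, action, bondSum_eq_of_frozen G J h hσ, ← Finset.sum_sdiff h]
  have : ∑ i ∈ Λ \ Λ₀, f i * spin σ i = ∑ i ∈ Λ \ Λ₀, f i :=
    Finset.sum_congr rfl fun i hi => by
      rw [spin_of_eq_one (hσ i (Finset.mem_sdiff.1 hi).2), mul_one]
  linarith

/-- Two disjoint sets of sites without bonds between them. -/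
def Separated (G : SimpleGraph (Site m)) (Λ₁ Λ₂ : Finset (Site m)) : Prop :=
  ∀ i ∈ Λ₁, ∀ j ∈ Λ₂, i ≠ j ∧ ¬ G.Adj i j

/-- No bond touches both volumes, and each volume sees only plus spins outside itself, so the
weights factorize. -/
theorem plusPartition_union (G : SimpleGraph (Site m)) [G.LocallyFinite] (J : ℝ)
    {Λ₁ Λ₂ : Finset (Site m)} (h : Separated G Λ₁ Λ₂) (f : Site m → ℝ) :
    plusPartition G J (Λ₁ ∪ Λ₂) f = plusPartition G J Λ₁ f * plusPartition G J Λ₂ f := by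
  have hd : Disjoint Λ₁ Λ₂ := Finset.disjoint_left.2 fun i h1 h2 => (h i h1 i h2).1 rfl
  have hbd : Disjoint (touchingBonds G Λ₁) (touchingBonds G Λ₂) := by
    refine Finset.disjoint_left.2 fun e => ?_
    induction e with
    | _ i j =>
      rw [mem_touchingBonds, mem_touchingBonds]
      rintro ⟨ha, h1⟩ ⟨-, h2⟩
      rcases h1 with h1 | h1 <;> rcases h2 with h2 | h2
      · exact (h _ h1 _ h2).1 rfl
      · exact (h _ h1 _ h2).2 ha
      · exact (h _ h1 _ h2).2 ha.symm
      · exact (h _ h1 _ h2).1 rfl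
  have hb : touchingBonds G (Λ₁ ∪ Λ₂) = touchingBonds G Λ₁ ∪ touchingBonds G Λ₂ :=
    Finset.union_biUnion
  simp only [plusPartition]
  rw [Finset.sum_mul_sum, ← Fintype.sum_prod_type', ← Equiv.sum_comp
    (Equiv.piFinsetUnion (fun _ => ℤˣ) hd)]
  refine Finset.sum_congr rfl fun p _ => ?_
  set σ := plusGlue (Λ₁ ∪ Λ₂) (Equiv.piFinsetUnion (fun _ => ℤˣ) hd p) with hσ
  have h1 : ∀ i ∉ Λ₂, spin σ i = spin (plusGlue Λ₁ p.1) i := by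
    intro i hi
    by_cases hi1 : i ∈ Λ₁
    · rw [spin, spin, hσ, plusGlue_apply_mem _ (Finset.mem_union_left _ hi1),
        plusGlue_apply_mem _ hi1]
      exact congrArg (fun s : ℤˣ => ((s : ℤ) : ℝ))
        (Equiv.piFinsetUnion_left (fun _ : Site m => ℤˣ) hd hi1 (Finset.mem_union_left _ hi1))
    · rw [spin, spin, hσ, plusGlue_apply_not_mem _ (by simp [hi, hi1]),
        plusGlue_apply_not_mem _ hi1]
  have h2 : ∀ i ∉ Λ₁, spin σ i = spin (plusGlue Λ₂ p.2) i := by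
    intro i hi
    by_cases hi1 : i ∈ Λ₂
    · rw [spin, spin, hσ, plusGlue_apply_mem _ (Finset.mem_union_right _ hi1),
        plusGlue_apply_mem _ hi1]
      exact congrArg (fun s : ℤˣ => ((s : ℤ) : ℝ))
        (Equiv.piFinsetUnion_right (fun _ : Site m => ℤˣ) hd hi1 (Finset.mem_union_right _ hi1))
    · rw [spin, spin, hσ, plusGlue_apply_not_mem _ (by simp [hi, hi1]),
        plusGlue_apply_not_mem _ hi1]
  have hb1 : ∀ e ∈ touchingBonds G Λ₁, J * (e.map (spin σ)).mul =
      J * (e.map (spin (plusGlue Λ₁ p.1))).mul := by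
    intro e
    induction e with
    | _ i j =>
      rw [mem_touchingBonds]
      rintro ⟨ha, hi | hj⟩
      · rw [map_spin_mul, map_spin_mul, h1 i fun h' => (h i hi i h').1 rfl,
          h1 j fun h' => (h i hi j h').2 ha]
      · rw [map_spin_mul, map_spin_mul, h1 j fun h' => (h j hj j h').1 rfl,
          h1 i fun h' => (h j hj i h').2 ha.symm]
  have hb2 : ∀ e ∈ touchingBonds G Λ₂, J * (e.map (spin σ)).mul =
      J * (e.map (spin (plusGlue Λ₂ p.2))).mul := by
    intro e
    induction e with
    | _ i j =>
      rw [mem_touchingBonds]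
      rintro ⟨ha, hi | hj⟩
      · rw [map_spin_mul, map_spin_mul, h2 i fun h' => (h i h' i hi).1 rfl,
          h2 j fun h' => (h j h' i hi).2 ha.symm]
      · rw [map_spin_mul, map_spin_mul, h2 j fun h' => (h j h' j hj).1 rfl,
          h2 i fun h' => (h i h' j hj).2 ha]
  have hf1 : ∀ i ∈ Λ₁, f i * spin σ i = f i * spin (plusGlue Λ₁ p.1) i := fun i hi => by
    rw [h1 i fun h' => (h i hi i h').1 rfl]
  have hf2 : ∀ i ∈ Λ₂, f i * spin σ i = f i * spin (plusGlue Λ₂ p.2) i := fun i hi => by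
    rw [h2 i fun h' => (h i h' i hi).1 rfl]
  rw [← Real.exp_add]
  simp only [action, bondSum]
  rw [hb, Finset.sum_union hbd, Finset.sum_union hd, Finset.sum_congr rfl hb1,
    Finset.sum_congr rfl hb2, Finset.sum_congr rfl hf1, Finset.sum_congr rfl hf2]
  congr 1
  ring

/-- Adjacency is compared only at sites of Λ. Besides translations and reflections, this allows the
identity map between two graphs that agree near Λ. -/
theorem plusPartition_map (G G' : SimpleGraph (Site m)) [G.LocallyFinite] [G'.LocallyFinite]
    (J : ℝ) (Λ : Finset (Site m)) (e : Site m ≃ Site m)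
    (he : ∀ i ∈ Λ, ∀ j, G'.Adj (e i) (e j) ↔ G.Adj i j) (f : Site m → ℝ) :
    plusPartition G' J (Λ.map e.toEmbedding) f = plusPartition G J Λ (f ∘ e) := by
  have hmem : ∀ i, e i ∈ Λ.map e.toEmbedding ↔ i ∈ Λ := fun i => by simp
  have htouch : ∀ i j, s(e i, e j) ∈ touchingBonds G' (Λ.map e.toEmbedding) ↔
      s(i, j) ∈ touchingBonds G Λ := by
    intro i j
    rw [mem_touchingBonds, mem_touchingBonds, hmem, hmem]
    constructor
    · rintro ⟨ha, hi | hj⟩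
      · exact ⟨(he i hi j).1 ha, Or.inl hi⟩
      · exact ⟨((he j hj i).1 ha.symm).symm, Or.inr hj⟩
    · rintro ⟨ha, hi | hj⟩
      · exact ⟨(he i hi j).2 ha, Or.inl hi⟩
      · exact ⟨((he j hj i).2 ha.symm).symm, Or.inr hj⟩
  simp only [plusPartition]
  refine Fintype.sum_equiv
    (Equiv.arrowCongr (e.subtypeEquiv fun i => (hmem i).symm).symm (Equiv.refl ℤˣ)) _ _ fun ω => ?_
  congr 1
  set ω' : Λ → ℤˣ := Equiv.arrowCongr (e.subtypeEquiv fun i => (hmem i).symm).symm (Equiv.refl ℤˣ) ω with hω'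
  have hspin : ∀ i, spin (plusGlue (Λ.map e.toEmbedding) ω) (e i) = spin (plusGlue Λ ω') i := by
    intro i
    by_cases hi : i ∈ Λ
    · rw [spin, spin, plusGlue_apply_mem _ ((hmem i).2 hi), plusGlue_apply_mem _ hi]
      rfl
    · rw [spin, spin, plusGlue_apply_not_mem _ (mt (hmem i).1 hi), plusGlue_apply_not_mem _ hi]
  simp only [action, bondSum, Finset.sum_map]
  congr 1
  · refine Finset.sum_bij' (fun b _ => b.map e.symm) (fun b _ => b.map e) ?_ ?_ ?_ ?_ ?_
    · intro b hb
      induction b with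
      | _ i j =>
        rw [Sym2.map_mk, ← htouch]
        simpa using hb
    · intro b hb
      induction b with
      | _ i j => simpa using (htouch i j).2 hb
    · intro b _; induction b with | _ i j => simp
    · intro b _; induction b with | _ i j => simp
    · intro b _
      induction b with
      | _ i j =>
        rw [Sym2.map_mk (f := e.symm), map_spin_mul, map_spin_mul, ← hspin, ← hspin]
        simp
  · exact Finset.sum_congr rfl fun i _ => by
      rw [Equiv.coe_toEmbedding, hspin]; rfl

end Volume

/-! ### The limit of a monotone, additive, translation invariant function of the volume -/

/-- A Fekete argument with lossy comparison factors. The limit is the supremum of ρ n * u n: the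
comparison puts u N eventually above anything below it, and u n ≤ sup / ρ n with ρ n → 1 bounds u
from above. -/
theorem exists_tendsto_of_eventually_mul_le {u ρ : ℕ → ℝ} {r : ℕ → ℕ → ℝ} {C : ℝ}
    (hu : ∀ n, u n ≤ C) (hr : ∀ n, ∀ᶠ N in atTop, r n N * u n ≤ u N)
    (hlim : ∀ n, Tendsto (r n) atTop (𝓝 (ρ n))) (hpos : ∀ n, 0 < ρ n)
    (hρ : Tendsto ρ atTop (𝓝 1)) : ∃ L, Tendsto u atTop (𝓝 L) := by
  have hC : ∀ n, ρ n * u n ≤ C := fun n =>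
    le_of_tendsto ((hlim n).mul_const (u n)) ((hr n).mono fun N hN => hN.trans (hu N))
  have hbdd : BddAbove (Set.range fun n => ρ n * u n) := ⟨C, by rintro _ ⟨n, rfl⟩; exact hC n⟩
  refine ⟨⨆ n, ρ n * u n, tendsto_order.2 ⟨fun a ha => ?_, fun b hb => ?_⟩⟩
  · obtain ⟨n, hn⟩ := exists_lt_of_lt_ciSup ha
    filter_upwards [hr n, ((hlim n).mul_const (u n)).eventually (lt_mem_nhds hn)] with N h1 h2
    exact h2.trans_le h1
  · have h1 : Tendsto (fun n => (⨆ n, ρ n * u n) / ρ n) atTop (𝓝 ((⨆ n, ρ n * u n) / 1)) :=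
      tendsto_const_nhds.div hρ one_ne_zero
    rw [div_one] at h1
    filter_upwards [h1.eventually (gt_mem_nhds hb)] with n hn
    refine lt_of_le_of_lt ?_ hn
    rw [le_div_iff₀ (hpos n), mul_comm]
    exact le_ciSup hbdd n

section Tiling

variable {m : ℕ}

theorem mem_box {n : ℕ} {i : Site m} :
    i ∈ box m n ↔ (1 ≤ height i ∧ height i ≤ n) ∧
      ∀ k : Fin m, -(n : ℤ) ≤ i k.castSucc ∧ i k.castSucc ≤ n := by
  simp only [box, Finset.mem_Icc, Pi.le_def, Fin.forall_fin_succ', if_true,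
    Fin.castSucc_ne_last, if_false, height]
  constructor
  · rintro ⟨⟨h1, h2⟩, h3, h4⟩; exact ⟨⟨h2, h4⟩, fun k => ⟨h1 k, h3 k⟩⟩
  · rintro ⟨⟨h2, h4⟩, h⟩; exact ⟨⟨fun k => (h k).1, h2⟩, fun k => (h k).2, h4⟩

/-- The horizontal sites at height `a` with coordinates between `-K` and `K`. -/
def horizontalBox (m : ℕ) (a : ℤ) (K : ℕ) : Finset (Site m) :=
  Finset.Icc (fun k => if k = Fin.last m then a else -(K : ℤ))
    (fun k => if k = Fin.last m then a else (K : ℤ))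

theorem mem_horizontalBox {a : ℤ} {K : ℕ} {i : Site m} :
    i ∈ horizontalBox m a K ↔ height i = a ∧
      ∀ k : Fin m, -(K : ℤ) ≤ i k.castSucc ∧ i k.castSucc ≤ K := by
  simp only [horizontalBox, Finset.mem_Icc, Pi.le_def, Fin.forall_fin_succ', if_true,
    Fin.castSucc_ne_last, if_false, height]
  constructor
  · rintro ⟨⟨h1, h2⟩, h3, h4⟩; exact ⟨le_antisymm h4 h2, fun k => ⟨h1 k, h3 k⟩⟩
  · rintro ⟨h2, h⟩; exact ⟨⟨fun k => (h k).1, h2.ge⟩, fun k => (h k).2, h2.le⟩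

theorem card_horizontalBox (a : ℤ) (K : ℕ) : (horizontalBox m a K).card = (2 * K + 1) ^ m := by
  rw [horizontalBox, Pi.card_Icc, Fin.prod_univ_castSucc]
  simp only [Fin.castSucc_ne_last, if_false, if_true, Int.card_Icc, Finset.prod_const,
    Finset.card_univ, Fintype.card_fin]
  have h1 : ((K : ℤ) + 1 - -(K : ℤ)).toNat = 2 * K + 1 := by omega
  have h2 : (a + 1 - a).toNat = 1 := by omega
  rw [h1, h2, mul_one]

theorem wall_eq {n : ℕ} (hn : 1 ≤ n) : wall m n = horizontalBox m 1 n := by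
  ext i
  rw [wall, Finset.mem_filter, mem_box, mem_horizontalBox]
  constructor
  · rintro ⟨⟨_, h⟩, h1⟩; exact ⟨h1, h⟩
  · rintro ⟨h1, h⟩; exact ⟨⟨⟨by omega, by omega⟩, h⟩, h1⟩

theorem card_wall {n : ℕ} (hn : 1 ≤ n) : (wall m n).card = (2 * n + 1) ^ m := by
  rw [wall_eq hn, card_horizontalBox]

/-- The translate of `box m n` by `2 n + 2` times `z`. -/
def tile (n : ℕ) (z : Site m) : Finset (Site m) :=
  (box m n).map (Equiv.addRight ((2 * (n : ℤ) + 2) • z)).toEmbedding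

theorem mem_tile {n : ℕ} {z i : Site m} :
    i ∈ tile n z ↔ ∃ j ∈ box m n, i = j + (2 * (n : ℤ) + 2) • z := by
  simp only [tile, Finset.mem_map_equiv]
  constructor
  · intro h; exact ⟨_, h, by simp⟩
  · rintro ⟨j, hj, rfl⟩; simpa using hj

theorem abs_sub_le_one_of_adj {i j : Site m} (h : (latticeGraph m).Adj i j) (k : Fin (m + 1)) :
    |i k - j k| ≤ 1 := by
  have h' : ∑ k, |i k - j k| = 1 := h
  rw [← h']
  exact Finset.single_le_sum (f := fun k => |i k - j k|) (fun _ _ => abs_nonneg _)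
    (Finset.mem_univ k)

/-- The period 2n + 2 exceeds the box width 2n + 1 by one, so different tiles differ by at least 2
in some horizontal coordinate. -/
theorem separated_tile {n : ℕ} {z z' : Site m} (hz : z ≠ z') (h : height z = height z') :
    Separated (latticeGraph m) (tile n z) (tile n z') := by
  have hk : ∃ k : Fin m, z k.castSucc ≠ z' k.castSucc := by
    by_contra! hall
    exact hz (funext fun k => Fin.lastCases h hall k)
  obtain ⟨k, hk⟩ := hk
  intro i hi j hj
  obtain ⟨i, hi', rfl⟩ := mem_tile.1 hi
  obtain ⟨j, hj', rfl⟩ := mem_tile.1 hj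
  have h1 := (mem_box.1 hi').2 k
  have h2 := (mem_box.1 hj').2 k
  have hfar : ¬ |(i + (2 * (n : ℤ) + 2) • z) k.castSucc -
      (j + (2 * (n : ℤ) + 2) • z') k.castSucc| ≤ 1 := by
    rw [abs_le]
    simp only [Pi.add_apply, Pi.smul_apply, smul_eq_mul]
    rcases lt_or_gt_of_ne hk with hk | hk
    · rintro ⟨h3, h4⟩
      nlinarith
    · rintro ⟨h3, h4⟩
      nlinarith
  refine ⟨fun he => hfar (by rw [he]; simp), fun ha => hfar (abs_sub_le_one_of_adj ha _)⟩

theorem upper_tile {n : ℕ} {z : Site m} (hz : height z = 0) : ∀ i ∈ tile n z, 1 ≤ height i := by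
  intro i hi
  obtain ⟨j, hj, rfl⟩ := mem_tile.1 hi
  have := (mem_box.1 hj).1.1
  simp only [height, Pi.add_apply, Pi.smul_apply, smul_eq_mul] at *
  rw [hz]
  linarith

theorem upper_box {n : ℕ} : ∀ i ∈ box m n, 1 ≤ height i := fun _ hi => (mem_box.1 hi).1.1

theorem tile_subset {n N K : ℕ} (h : (2 * n + 2) * K + n ≤ N) {z : Site m}
    (hz : z ∈ horizontalBox m 0 K) : tile n z ⊆ box m N := by
  intro i hi
  obtain ⟨j, hj, rfl⟩ := mem_tile.1 hi
  rw [mem_horizontalBox] at hz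
  rw [mem_box] at hj ⊢
  have h' : (2 * (n : ℤ) + 2) * K + n ≤ N := by exact_mod_cast h
  have hK : 0 ≤ (2 * (n : ℤ) + 2) * K := by positivity
  simp only [height, Pi.add_apply, Pi.smul_apply, smul_eq_mul] at *
  refine ⟨?_, fun k => ?_⟩
  · rw [hz.1]
    constructor <;> linarith [hj.1.1, hj.1.2]
  · have h1 := hz.2 k
    have h2 := hj.2 k
    constructor <;> nlinarith

/-- A monotone function of the finite volumes of the half-lattice which is additive over separated
volumes and invariant under horizontal translations has a limit per wall site. -/
theorem exists_tendsto_div_card_wall (V : Finset (Site m) → ℝ) {C : ℝ}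
    (hmono : ∀ Λ₀ Λ, (∀ i ∈ Λ, 1 ≤ height i) → Λ₀ ⊆ Λ → V Λ₀ ≤ V Λ)
    (hadd : ∀ Λ₁ Λ₂, (∀ i ∈ Λ₁, 1 ≤ height i) → (∀ i ∈ Λ₂, 1 ≤ height i) →
      Separated (latticeGraph m) Λ₁ Λ₂ → V (Λ₁ ∪ Λ₂) = V Λ₁ + V Λ₂)
    (htrans : ∀ (Λ : Finset (Site m)) (v : Site m), (∀ i ∈ Λ, 1 ≤ height i) → height v = 0 →
      V (Λ.map (Equiv.addRight v).toEmbedding) = V Λ)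
    (hbound : ∀ n, V (box m n) ≤ C * (wall m n).card) :
    ∃ L, Tendsto (fun n => V (box m n) / (wall m n).card) atTop (𝓝 L) := by
  have hempty : V ∅ = 0 := by
    have := hadd ∅ ∅ (by simp) (by simp) (by intro i hi; simp at hi)
    simp only [Finset.union_empty] at this
    linarith
  have hnonneg : ∀ n, 0 ≤ V (box m n) := fun n =>
    hempty ▸ hmono _ _ upper_box (Finset.empty_subset _)
  have htiles : ∀ (n : ℕ) (T : Finset (Site m)), (∀ z ∈ T, height z = 0) →
      V (T.biUnion (tile n)) = T.card * V (box m n) := by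
    intro n T
    induction T using Finset.induction_on with
    | empty => simp [hempty]
    | insert z T hz ih =>
      intro hT
      have hT' : ∀ y ∈ T, height y = 0 := fun y hy => hT y (Finset.mem_insert_of_mem hy)
      have hz0 := hT z (Finset.mem_insert_self z T)
      rw [Finset.biUnion_insert, hadd _ _ (upper_tile hz0), ih hT', tile,
        htrans _ _ upper_box, Finset.card_insert_of_notMem hz]
      · push_cast; ring
      · simpa [height] using Or.inr hz0
      · intro i hi
        obtain ⟨y, hy, hi⟩ := Finset.mem_biUnion.1 hi
        exact upper_tile (hT' y hy) i hi
      · intro i hi j hj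
        obtain ⟨y, hy, hj⟩ := Finset.mem_biUnion.1 hj
        exact separated_tile (fun h : z = y => hz (h ▸ hy)) (hz0.trans (hT' y hy).symm) i hi j hj
  -- Only one layer of tiles is placed, along the wall; monotonicity accounts for the rest of the
  -- larger box.
  have hcompare : ∀ n N K : ℕ, (2 * n + 2) * K + n ≤ N →
      (2 * (K : ℝ) + 1) ^ m * V (box m n) ≤ V (box m N) := by
    intro n N K h
    have h1 := htiles n (horizontalBox m 0 K) fun z hz => (mem_horizontalBox.1 hz).1
    rw [card_horizontalBox] at h1
    push_cast at h1
    rw [← h1]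
    exact hmono _ _ upper_box (Finset.biUnion_subset.2 fun z hz => tile_subset h hz)
  -- The explicit denominator agrees with the wall area for n ≥ 1 and stays positive at n = 0, where
  -- the wall is empty.
  set u : ℕ → ℝ := fun n => V (box m n) / (2 * (n : ℝ) + 1) ^ m with hu
  have hcard : ∀ n, 1 ≤ n → ((wall m n).card : ℝ) = (2 * (n : ℝ) + 1) ^ m := fun n hn => by
    rw [card_wall hn]; push_cast; ring
  have hu_nonneg : ∀ n, 0 ≤ u n := fun n => div_nonneg (hnonneg n) (by positivity)
  suffices ∃ L, Tendsto u atTop (𝓝 L) by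
    obtain ⟨L, hL⟩ := this
    refine ⟨L, hL.congr' ?_⟩
    filter_upwards [eventually_ge_atTop 1] with n hn
    rw [hcard n hn]
  have hbox0 : box m 0 = ∅ := by
    ext i
    rw [mem_box]
    simp only [Finset.notMem_empty, iff_false]
    rintro ⟨⟨h1, h2⟩, -⟩
    push_cast at h2
    omega
  have hwall0 : V (box m 0) = 0 := by rw [hbox0, hempty]
  -- `ρ n` is the limiting fraction of the wall covered by tiles; `r n N` bounds from below the
  -- fraction covered inside the box of size N.
  refine exists_tendsto_of_eventually_mul_le (C := max C 0)
    (ρ := fun n => ((2 * (n : ℝ) + 1) / (2 * n + 2)) ^ m)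
    (r := fun n N => (((2 * (N : ℝ) - 4 * n - 2) / (2 * N + 1)) *
      ((2 * (n : ℝ) + 1) / (2 * n + 2))) ^ m) ?_ ?_ ?_ ?_ ?_
  · intro n
    rcases Nat.eq_zero_or_pos n with rfl | hn
    · simp [hu, hwall0]
    · rw [hu]
      beta_reduce
      rw [div_le_iff₀ (by positivity), ← hcard n hn]
      exact (hbound n).trans (mul_le_mul_of_nonneg_right (le_max_left _ _) (by positivity))
  · intro n
    filter_upwards [eventually_ge_atTop (2 * n + 1)] with N hN
    -- The largest K for which the tiles with horizontal indices in [-K, K] fit into the box of size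
    -- N.
    set K := (N - n) / (2 * n + 2) with hK
    have h1 : (2 * n + 2) * K + n ≤ N := by
      have := Nat.mul_div_le (N - n) (2 * n + 2)
      rw [← hK] at this
      omega
    have h2 : N - n < (2 * n + 2) * (K + 1) := by
      have := Nat.lt_mul_div_succ (N - n) (show 0 < 2 * n + 2 by omega)
      rwa [← hK] at this
    have h2' : (N : ℝ) < (2 * n + 2) * (K + 1) + n := by
      have : N < (2 * n + 2) * (K + 1) + n := by omega
      exact_mod_cast this
    have hN' : (2 * (n : ℝ) + 1) ≤ N := by exact_mod_cast hN
    have h3 := hcompare n N K h1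
    have h4 : (2 * (N : ℝ) - 4 * n - 2) / (2 * n + 2) ≤ 2 * K + 1 := by
      rw [div_le_iff₀ (by positivity)]
      nlinarith
    have h5 : (0 : ℝ) ≤ (2 * (N : ℝ) - 4 * n - 2) / (2 * n + 2) :=
      div_nonneg (by linarith) (by positivity)
    have h6 := mul_le_mul_of_nonneg_right (pow_le_pow_left₀ h5 h4 m) (hnonneg n)
    rw [hu]
    beta_reduce
    rw [le_div_iff₀ (by positivity)]
    refine le_trans (le_of_eq ?_) (h6.trans h3)
    rw [mul_pow, div_pow, div_pow, div_pow]
    field_simp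
  · intro n
    have h1 : Tendsto (fun N : ℕ => (2 * (N : ℝ) - 4 * n - 2) / (2 * N + 1)) atTop (𝓝 1) := by
      have h2 : Tendsto (fun N : ℕ => 2 * (N : ℝ) + 1) atTop atTop :=
        tendsto_atTop_add_const_right _ _
          (tendsto_natCast_atTop_atTop.const_mul_atTop two_pos)
      have h3 : Tendsto (fun N : ℕ => 1 - (4 * (n : ℝ) + 3) / (2 * N + 1)) atTop (𝓝 (1 - 0)) :=
        tendsto_const_nhds.sub (tendsto_const_nhds.div_atTop h2)
      rw [sub_zero] at h3
      refine h3.congr fun N => ?_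
      have : (2 * (N : ℝ) + 1) ≠ 0 := by positivity
      field_simp
      ring
    simpa using (h1.mul_const ((2 * (n : ℝ) + 1) / (2 * n + 2))).pow m
  · intro n
    positivity
  · have h2 : Tendsto (fun N : ℕ => 2 * (N : ℝ) + 2) atTop atTop :=
      tendsto_atTop_add_const_right _ _ (tendsto_natCast_atTop_atTop.const_mul_atTop two_pos)
    have h3 : Tendsto (fun N : ℕ => 1 - (1 : ℝ) / (2 * N + 2)) atTop (𝓝 (1 - 0)) :=
      tendsto_const_nhds.sub (tendsto_const_nhds.div_atTop h2)
    have h4 : Tendsto (fun n : ℕ => (2 * (n : ℝ) + 1) / (2 * n + 2)) atTop (𝓝 1) := by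
      rw [sub_zero] at h3
      refine h3.congr fun N => ?_
      have : (2 * (N : ℝ) + 2) ≠ 0 := by positivity
      field_simp
      ring
    simpa using h4.pow m

end Tiling

/-! ### Existence of the surface free energies -/

section SurfaceLimit

variable {m : ℕ}

/-! ### Translations, the reflection, and bonds crossing the wall -/

theorem latticeGraph_adj_add (v i j : Site m) :
    (latticeGraph m).Adj (i + v) (j + v) ↔ (latticeGraph m).Adj i j := by
  simp [latticeGraph]

theorem height_add (i v : Site m) : height (i + v) = height i + height v := rfl

theorem halfGraph_adj_add {v : Site m} (hv : height v = 0) (i j : Site m) :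
    (halfGraph m).Adj (i + v) (j + v) ↔ (halfGraph m).Adj i j := by
  simp only [halfGraph, latticeGraph_adj_add, height_add, hv, add_zero]

theorem height_reflect (i : Site m) : height (reflect i) = 1 - height i := by
  simp [reflect, height]

theorem reflect_castSucc (i : Site m) (k : Fin m) : reflect i k.castSucc = i k.castSucc := by
  simp [reflect]

theorem site_ext {i j : Site m} (h : height i = height j)
    (hk : ∀ k : Fin m, i k.castSucc = j k.castSucc) : i = j :=
  funext fun k => Fin.lastCases h hk k

theorem reflect_reflect (i : Site m) : reflect (reflect i) = i := by
  refine site_ext ?_ fun k => ?_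
  · rw [height_reflect, height_reflect]; ring
  · rw [reflect_castSucc, reflect_castSucc]

/-- The reflection as a permutation of the lattice. -/
def reflectEquiv (m : ℕ) : Site m ≃ Site m :=
  ⟨reflect, reflect, reflect_reflect, reflect_reflect⟩

theorem latticeGraph_adj_iff (i j : Site m) : (latticeGraph m).Adj i j ↔
    ∑ k : Fin m, |i k.castSucc - j k.castSucc| + |height i - height j| = 1 := by
  change ∑ k, |i k - j k| = 1 ↔ _
  rw [Fin.sum_univ_castSucc]
  rfl

theorem latticeGraph_adj_reflect (i j : Site m) :
    (latticeGraph m).Adj (reflect i) (reflect j) ↔ (latticeGraph m).Adj i j := by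
  simp only [latticeGraph_adj_iff, reflect_castSucc, height_reflect]
  rw [show 1 - height i - (1 - height j) = -(height i - height j) by ring, abs_neg]

/-- A bond crossing the wall joins a wall site with its reflection. -/
theorem adj_crossing_iff {i j : Site m} (hi : 1 ≤ height i) (hj : height j ≤ 0) :
    (latticeGraph m).Adj i j ↔ height i = 1 ∧ j = reflect i := by
  rw [latticeGraph_adj_iff]
  have hs : 0 ≤ ∑ k : Fin m, |i k.castSucc - j k.castSucc| :=
    Finset.sum_nonneg fun _ _ => abs_nonneg _
  have hab : |height i - height j| = height i - height j := abs_of_nonneg (by omega)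
  constructor
  · intro h
    rw [hab] at h
    have h0 : ∑ k : Fin m, |i k.castSucc - j k.castSucc| = 0 := by omega
    rw [Finset.sum_eq_zero_iff_of_nonneg fun _ _ => abs_nonneg _] at h0
    refine ⟨by omega, site_ext ?_ fun k => ?_⟩
    · rw [height_reflect]; omega
    · have := h0 k (Finset.mem_univ k)
      rw [reflect_castSucc]
      rw [abs_eq_zero] at this
      omega
  · rintro ⟨h1, rfl⟩
    simp [reflect_castSucc, height_reflect, h1]

/-! ### The pure contribution: coupling the two half-lattices through the wall -/

/-- The lattice without the bonds crossing the wall. -/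
def cutGraph (m : ℕ) : SimpleGraph (Site m) where
  Adj i j := (latticeGraph m).Adj i j ∧ (1 ≤ height i ↔ 1 ≤ height j)
  symm := ⟨fun _ _ h => ⟨h.1.symm, h.2.symm⟩⟩
  loopless := ⟨fun i h => (latticeGraph m).loopless.irrefl i h.1⟩

instance (m : ℕ) : (cutGraph m).LocallyFinite := fun i =>
  ((latticeGraph_neighborSet_finite m i).subset fun _ hj => hj.1).fintype

theorem cutGraph_adj_reflect (i j : Site m) :
    (cutGraph m).Adj (reflect i) (reflect j) ↔ (cutGraph m).Adj i j := by
  simp only [cutGraph, latticeGraph_adj_reflect, height_reflect]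
  refine and_congr_right fun _ => ?_
  constructor <;> intro h <;> omega

theorem cutGraph_adj_add {v : Site m} (hv : height v = 0) (i j : Site m) :
    (cutGraph m).Adj (i + v) (j + v) ↔ (cutGraph m).Adj i j := by
  simp only [cutGraph, latticeGraph_adj_add, height_add, hv, add_zero]

/-- The union of a volume and its reflection. -/
def double (Λ : Finset (Site m)) : Finset (Site m) := Λ ∪ Λ.map (reflectEquiv m).toEmbedding

theorem mem_map_reflect {Λ : Finset (Site m)} {i : Site m} :
    i ∈ Λ.map (reflectEquiv m).toEmbedding ↔ reflect i ∈ Λ := by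
  rw [Finset.mem_map_equiv]; rfl

theorem mem_double {Λ : Finset (Site m)} {i : Site m} :
    i ∈ double Λ ↔ i ∈ Λ ∨ reflect i ∈ Λ := by
  rw [double, Finset.mem_union, mem_map_reflect]

theorem extendedBox_eq_double (m n : ℕ) : extendedBox m n = double (box m n) := by
  rw [extendedBox, double, Finset.map_eq_image]; rfl

theorem double_mono {Λ₀ Λ : Finset (Site m)} (h : Λ₀ ⊆ Λ) : double Λ₀ ⊆ double Λ := by
  intro i hi
  rw [mem_double] at *
  exact hi.imp (fun h' => h h') fun h' => h h'

/-- The decoupled model on the doubled volume is the square of the half-lattice model. -/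
theorem plusPartition_cutGraph (J : ℝ) {Λ : Finset (Site m)} (hΛ : ∀ i ∈ Λ, 1 ≤ height i) :
    plusPartition (cutGraph m) J (double Λ) 0 = plusPartition (halfGraph m) J Λ 0 ^ 2 := by
  have hsep : Separated (cutGraph m) Λ (Λ.map (reflectEquiv m).toEmbedding) := by
    intro i hi j hj
    have h1 := hΛ i hi
    have h2 := hΛ _ (mem_map_reflect.1 hj)
    rw [height_reflect] at h2
    refine ⟨fun h => by subst h; omega, fun h => ?_⟩
    have := h.2.1 h1
    omega
  have hrefl := plusPartition_map (cutGraph m) (cutGraph m) J Λ (reflectEquiv m)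
    (fun i _ j => cutGraph_adj_reflect i j) 0
  have hhalf := plusPartition_map (halfGraph m) (cutGraph m) J Λ (Equiv.refl _)
    (fun i hi j => ⟨fun h => ⟨h.1, hΛ i hi, h.2.1 (hΛ i hi)⟩,
      fun h => ⟨h.1, iff_of_true h.2.1 h.2.2⟩⟩) 0
  rw [Equiv.refl_toEmbedding, Finset.map_refl] at hhalf
  rw [double, plusPartition_union _ _ hsep, hrefl, sq]
  exact congrArg₂ (· * ·) hhalf hhalf

/-- The bonds lost by cutting are exactly those joining a wall site of Λ to its mirror image, one
for each wall site. -/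
theorem bondSum_double (J : ℝ) {Λ : Finset (Site m)} (hΛ : ∀ i ∈ Λ, 1 ≤ height i)
    (σ : Config m) :
    bondSum (latticeGraph m) J (double Λ) σ = bondSum (cutGraph m) J (double Λ) σ +
      ∑ i ∈ Λ with height i = 1, J * (spin σ i * spin σ (reflect i)) := by
  have hinj : Set.InjOn (fun i : Site m => s(i, reflect i))
      ((Λ.filter fun i => height i = 1 : Finset (Site m)) : Set (Site m)) := by
    intro i hi j hj h
    simp only [Finset.coe_filter, Set.mem_ofPred_eq] at hi hj
    rcases Sym2.eq_iff.1 h with h | h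
    · exact h.1
    · have := congrArg height h.1
      rw [height_reflect] at this
      omega
  have hd : Disjoint (touchingBonds (cutGraph m) (double Λ))
      ((Λ.filter fun i => height i = 1).image fun i => s(i, reflect i)) := by
    refine Finset.disjoint_right.2 fun e he he' => ?_
    obtain ⟨i, hi, rfl⟩ := Finset.mem_image.1 he
    rw [Finset.mem_filter] at hi
    have := (mem_touchingBonds.1 he').1.2.1 (by omega)
    rw [height_reflect] at this
    omega
  have hu : touchingBonds (latticeGraph m) (double Λ) = touchingBonds (cutGraph m) (double Λ) ∪
      (Λ.filter fun i => height i = 1).image fun i => s(i, reflect i) := by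
    ext e
    induction e with
    | _ i j =>
      rw [Finset.mem_union, mem_touchingBonds, mem_touchingBonds, Finset.mem_image]
      constructor
      · rintro ⟨ha, hij⟩
        have hmem : ∀ i : Site m, 1 ≤ height i → (i ∈ double Λ ∨ reflect i ∈ double Λ) →
            i ∈ Λ := by
          intro i hi h
          rw [mem_double, mem_double, reflect_reflect] at h
          have h' : reflect i ∉ Λ := fun h => by
            have := hΛ _ h
            rw [height_reflect] at this
            omega
          tauto
        by_cases hc : 1 ≤ height i ↔ 1 ≤ height j
        · exact Or.inl ⟨⟨ha, hc⟩, hij⟩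
        · right
          by_cases hi : 1 ≤ height i
          · have hj : height j ≤ 0 := by by_contra hj; exact hc (iff_of_true hi (by omega))
            obtain ⟨h1, rfl⟩ := (adj_crossing_iff hi hj).1 ha
            exact ⟨i, Finset.mem_filter.2 ⟨hmem i hi hij, h1⟩, rfl⟩
          · have hj : 1 ≤ height j := by by_contra hj; exact hc (iff_of_false hi hj)
            obtain ⟨h1, rfl⟩ := (adj_crossing_iff hj (by omega)).1 ha.symm
            exact ⟨j, Finset.mem_filter.2 ⟨hmem j hj hij.symm, h1⟩, Sym2.eq_swap⟩
      · rintro (h | ⟨k, hk, h⟩)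
        · exact ⟨h.1.1, h.2⟩
        · rw [Finset.mem_filter] at hk
          have hadj : (latticeGraph m).Adj k (reflect k) :=
            (adj_crossing_iff (by omega) (by rw [height_reflect]; omega)).2 ⟨hk.2, rfl⟩
          have hkd : k ∈ double Λ := mem_double.2 (Or.inl hk.1)
          rcases Sym2.eq_iff.1 h with ⟨rfl, rfl⟩ | ⟨rfl, rfl⟩
          · exact ⟨hadj, Or.inl hkd⟩
          · exact ⟨hadj.symm, Or.inr hkd⟩
  rw [bondSum, hu, Finset.sum_union hd, Finset.sum_image hinj]
  rfl

/-- The increase of the surface energy due to the coupling through the wall, for the pure model. -/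
def wallDefect (m : ℕ) (J : ℝ) (Λ : Finset (Site m)) : ℝ :=
  J * (Λ.filter fun i => height i = 1).card -
    (Real.log (plusPartition (latticeGraph m) J (double Λ) 0) -
      Real.log (plusPartition (cutGraph m) J (double Λ) 0))

/-- Freezing applies to the full model against the cut one, since the full action at σ plus the cut
action at στ is a twisted cut action plus the ferromagnetic crossing bonds. Each frozen crossing
bond has energy J, which the main term J times the wall area absorbs. -/
theorem wallDefect_mono {J : ℝ} (hJ : 0 ≤ J) {Λ₀ Λ : Finset (Site m)}
    (hΛ : ∀ i ∈ Λ, 1 ≤ height i) (h : Λ₀ ⊆ Λ) : wallDefect m J Λ₀ ≤ wallDefect m J Λ := by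
  have hd := double_mono h
  have key := log_ratio_le hd (u := action (latticeGraph m) J (double Λ) 0)
    (w := action (cutGraph m) J (double Λ) 0) (u₀ := action (latticeGraph m) J (double Λ₀) 0)
    (w₀ := action (cutGraph m) J (double Λ₀) 0)
    (fun σ hσ => action_eq_of_frozen _ J hd 0 hσ) (fun σ hσ => action_eq_of_frozen _ J hd 0 hσ)
    (fun τ => by
      have hcross : (fun ω => ∑ i ∈ Λ with height i = 1, J *
          (spin (plusGlue (double Λ) ω) i * spin (plusGlue (double Λ) ω) (reflect i))) ∈
          spinCone (double Λ) :=
        sum_fun_mem fun i _ => (spinCone _).mul_mem (const_mem_productCone _ hJ)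
          ((spinCone _).mul_mem (spin_mem_spinCone _ _) (spin_mem_spinCone _ _))
      convert! (spinCone (double Λ)).add_mem (twist_mem_spinCone
        (bondSum_mem_spinCone (cutGraph m) hJ (double Λ) (double Λ)) τ).1 hcross using 1
      ext ω
      simp only [action, bondSum_double J hΛ, Pi.add_apply, Pi.zero_apply, zero_mul,
        Finset.sum_const_zero]
      ring)
  have hone : ∀ Λ : Finset (Site m), (∀ i ∈ Λ, 1 ≤ height i) →
      bondSum (latticeGraph m) J (double Λ) 1 = bondSum (cutGraph m) J (double Λ) 1 +
        J * (Λ.filter fun i => height i = 1).card := by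
    intro Λ hΛ
    rw [bondSum_double J hΛ, Finset.sum_congr rfl fun i _ => by
      rw [spin_of_eq_one (Pi.one_apply i), spin_of_eq_one (Pi.one_apply (reflect i)), mul_one,
        mul_one], Finset.sum_const, nsmul_eq_mul, mul_comm J]
  rw [hone Λ hΛ, hone Λ₀ fun i hi => hΛ i (h hi)] at key
  simp only [wallDefect]
  simp only [plusPartition]
  linarith

theorem separated_double {Λ₁ Λ₂ : Finset (Site m)} (h₁ : ∀ i ∈ Λ₁, 1 ≤ height i)
    (h₂ : ∀ i ∈ Λ₂, 1 ≤ height i) (h : Separated (latticeGraph m) Λ₁ Λ₂) :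
    Separated (latticeGraph m) (double Λ₁) (double Λ₂) := by
  have hcross : ∀ i ∈ Λ₁, ∀ j, reflect j ∈ Λ₂ → i ≠ j ∧ ¬ (latticeGraph m).Adj i j := by
    intro i hi j hj
    have hi' := h₁ i hi
    have hj' := h₂ _ hj
    rw [height_reflect] at hj'
    refine ⟨fun he => by subst he; omega, fun ha => ?_⟩
    obtain ⟨-, rfl⟩ := (adj_crossing_iff hi' (by omega)).1 ha
    rw [reflect_reflect] at hj
    exact (h i hi i hj).1 rfl
  intro i hi j hj
  rw [mem_double] at hi hj
  rcases hi with hi | hi <;> rcases hj with hj | hj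
  · exact h i hi j hj
  · exact hcross i hi j hj
  · have := hcross _ hi (reflect j) (by rwa [reflect_reflect])
    rw [latticeGraph_adj_reflect] at this
    exact ⟨fun he => this.1 (he ▸ rfl), this.2⟩
  · have := h _ hi _ hj
    rw [latticeGraph_adj_reflect] at this
    exact ⟨fun he => this.1 (he ▸ rfl), this.2⟩

theorem log_plusPartition_union (G : SimpleGraph (Site m)) [G.LocallyFinite] (J : ℝ)
    {Λ₁ Λ₂ : Finset (Site m)} (h : Separated G Λ₁ Λ₂) (f : Site m → ℝ) :
    Real.log (plusPartition G J (Λ₁ ∪ Λ₂) f) =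
      Real.log (plusPartition G J Λ₁ f) + Real.log (plusPartition G J Λ₂ f) := by
  rw [plusPartition_union G J h,
    Real.log_mul (plusPartition_pos _ _ _ _).ne' (plusPartition_pos _ _ _ _).ne']

theorem disjoint_of_separated {G : SimpleGraph (Site m)} {Λ₁ Λ₂ : Finset (Site m)}
    (h : Separated G Λ₁ Λ₂) : Disjoint Λ₁ Λ₂ :=
  Finset.disjoint_left.2 fun i h1 h2 => (h i h1 i h2).1 rfl

theorem wallDefect_union (J : ℝ) {Λ₁ Λ₂ : Finset (Site m)} (h₁ : ∀ i ∈ Λ₁, 1 ≤ height i)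
    (h₂ : ∀ i ∈ Λ₂, 1 ≤ height i) (h : Separated (latticeGraph m) Λ₁ Λ₂) :
    wallDefect m J (Λ₁ ∪ Λ₂) = wallDefect m J Λ₁ + wallDefect m J Λ₂ := by
  have hd : double (Λ₁ ∪ Λ₂) = double Λ₁ ∪ double Λ₂ := by
    ext i
    simp only [mem_double, Finset.mem_union]
    tauto
  have hs := separated_double h₁ h₂ h
  have hs' : Separated (cutGraph m) (double Λ₁) (double Λ₂) := fun i hi j hj =>
    ⟨(hs i hi j hj).1, fun ha => (hs i hi j hj).2 ha.1⟩
  simp only [wallDefect, hd]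
  rw [log_plusPartition_union _ J hs, log_plusPartition_union _ J hs', Finset.filter_union,
    Finset.card_union_of_disjoint (Finset.disjoint_filter_filter (disjoint_of_separated h))]
  push_cast
  ring

theorem reflect_add {v : Site m} (hv : height v = 0) (i : Site m) :
    reflect (i + v) = reflect i + v := by
  refine site_ext ?_ fun k => ?_
  · rw [height_reflect, height_add, height_add, height_reflect, hv]; ring
  · simp only [reflect_castSucc, Pi.add_apply]

theorem mem_map_addRight {Λ : Finset (Site m)} {v i : Site m} :
    i ∈ Λ.map (Equiv.addRight v).toEmbedding ↔ i - v ∈ Λ := by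
  rw [Finset.mem_map_equiv, Equiv.addRight_symm]
  simp [sub_eq_add_neg]

theorem double_map_addRight (Λ : Finset (Site m)) {v : Site m} (hv : height v = 0) :
    double (Λ.map (Equiv.addRight v).toEmbedding) =
      (double Λ).map (Equiv.addRight v).toEmbedding := by
  ext i
  have : reflect (i - v) = reflect i - v := by
    rw [eq_sub_iff_add_eq, ← reflect_add hv, sub_add_cancel]
  rw [mem_double, mem_map_addRight, mem_map_addRight, mem_map_addRight, mem_double, this]

theorem wallDefect_translate (J : ℝ) (Λ : Finset (Site m)) {v : Site m} (hv : height v = 0) :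
    wallDefect m J (Λ.map (Equiv.addRight v).toEmbedding) = wallDefect m J Λ := by
  have h1 : plusPartition (latticeGraph m) J
      ((double Λ).map (Equiv.addRight v).toEmbedding) 0 =
      plusPartition (latticeGraph m) J (double Λ) 0 :=
    plusPartition_map _ _ J _ _ (fun i _ j => latticeGraph_adj_add v i j) 0
  have h2 : plusPartition (cutGraph m) J
      ((double Λ).map (Equiv.addRight v).toEmbedding) 0 =
      plusPartition (cutGraph m) J (double Λ) 0 :=
    plusPartition_map _ _ J _ _ (fun i _ j => cutGraph_adj_add hv i j) 0
  have h3 : ((Λ.map (Equiv.addRight v).toEmbedding).filter fun i => height i = 1).card =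
      (Λ.filter fun i => height i = 1).card := by
    rw [Finset.filter_map, Finset.card_map]
    congr 1
    refine Finset.filter_congr fun i _ => ?_
    simp [height_add, hv]
  rw [wallDefect, wallDefect, double_map_addRight Λ hv, h1, h2, h3]

theorem abs_spin (σ : Config m) (i : Site m) : |spin σ i| = 1 := by
  rcases Int.units_eq_one_or (σ i) with h | h <;> simp [spin, h]

/-- Each crossing bond contributes at least -J, so restoring these bonds lowers the logarithm by at
most J per wall site. -/
theorem wallDefect_box_le {J : ℝ} (hJ : 0 ≤ J) (n : ℕ) :
    wallDefect m J (box m n) ≤ 2 * J * (wall m n).card := by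
  have h : Real.exp (-(J * (wall m n).card)) *
      plusPartition (cutGraph m) J (double (box m n)) 0 ≤
      plusPartition (latticeGraph m) J (double (box m n)) 0 := by
    simp only [plusPartition, Finset.mul_sum, ← Real.exp_add]
    refine Finset.sum_le_sum fun ω _ => Real.exp_le_exp.2 ?_
    set σ := plusGlue (double (box m n)) ω
    simp only [action, bondSum_double J upper_box, Pi.zero_apply, zero_mul,
      Finset.sum_const_zero, add_zero]
    have : ∑ i ∈ box m n with height i = 1, -J ≤
        ∑ i ∈ box m n with height i = 1, J * (spin σ i * spin σ (reflect i)) := by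
      refine Finset.sum_le_sum fun i _ => ?_
      have h1 : |spin σ i * spin σ (reflect i)| = 1 := by rw [abs_mul, abs_spin, abs_spin, mul_one]
      have h2 := (abs_le.1 h1.le).1
      nlinarith
    rw [Finset.sum_const, nsmul_eq_mul] at this
    rw [wall]
    linarith
  have h1 := Real.log_le_log (mul_pos (Real.exp_pos _) (plusPartition_pos _ _ _ _)) h
  rw [Real.log_mul (Real.exp_pos _).ne' (plusPartition_pos _ _ _ _).ne', Real.log_exp] at h1
  rw [wallDefect, ← wall]
  linarith

/-! ### The contribution of the field -/

/-- The deficit of the free energy gain of the field `f` over the field `-κ f`. -/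
def fieldDefect (m : ℕ) (κ J : ℝ) (f : Site m → ℝ) (Λ : Finset (Site m)) : ℝ :=
  (1 + κ) * ∑ i ∈ Λ, f i - (Real.log (plusPartition (halfGraph m) J Λ f) -
    Real.log (plusPartition (halfGraph m) J Λ (-κ • f)))

/-- With F and F' the field energies at σ and στ, the field part of the twisted action is F - κF' =
κ(F - F') + (1 - κ)F, which lies in the cone for κ in [0, 1]. -/
theorem fieldDefect_mono {κ J : ℝ} (hκ₀ : 0 ≤ κ) (hκ₁ : κ ≤ 1) (hJ : 0 ≤ J) {f : Site m → ℝ}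
    {Λ₀ Λ : Finset (Site m)} (hf : ∀ i ∈ Λ, 0 ≤ f i) (h : Λ₀ ⊆ Λ) :
    fieldDefect m κ J f Λ₀ ≤ fieldDefect m κ J f Λ := by
  have key := log_ratio_le h (u := action (halfGraph m) J Λ f)
    (w := action (halfGraph m) J Λ (-κ • f)) (u₀ := action (halfGraph m) J Λ₀ f)
    (w₀ := action (halfGraph m) J Λ₀ (-κ • f))
    (fun σ hσ => action_eq_of_frozen _ J h f hσ) (fun σ hσ => action_eq_of_frozen _ J h _ hσ)
    (fun τ => by
      have hF := sum_field_mem_spinCone Λ Λ hf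
      have hc := const_mem_productCone (ι := Λ) spinSemiring hκ₀
      have hc' := const_mem_productCone (ι := Λ) spinSemiring (sub_nonneg.2 hκ₁)
      convert! (spinCone Λ).add_mem (twist_mem_spinCone
        (bondSum_mem_spinCone (halfGraph m) hJ Λ Λ) τ).1 ((spinCone Λ).add_mem
          ((spinCone Λ).mul_mem hc (twist_mem_spinCone hF τ).2)
          ((spinCone Λ).mul_mem hc' hF)) using 1
      ext ω
      simp only [action, Pi.add_apply, Pi.mul_apply, Pi.smul_apply, smul_eq_mul, neg_mul,
        Finset.sum_neg_distrib, mul_assoc, ← Finset.mul_sum]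
      ring)
  have hs := Finset.sum_sdiff h (f := f)
  have hs' : ∑ i ∈ Λ \ Λ₀, (-κ • f) i = -κ * ∑ i ∈ Λ \ Λ₀, f i := by
    simp [Finset.mul_sum]
  rw [hs'] at key
  simp only [fieldDefect]
  simp only [plusPartition]
  rw [← hs]
  linarith

theorem fieldDefect_union (κ J : ℝ) (f : Site m → ℝ) {Λ₁ Λ₂ : Finset (Site m)}
    (h : Separated (latticeGraph m) Λ₁ Λ₂) :
    fieldDefect m κ J f (Λ₁ ∪ Λ₂) = fieldDefect m κ J f Λ₁ + fieldDefect m κ J f Λ₂ := by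
  have hs : Separated (halfGraph m) Λ₁ Λ₂ := fun i hi j hj =>
    ⟨(h i hi j hj).1, fun ha => (h i hi j hj).2 ha.1⟩
  simp only [fieldDefect]
  rw [log_plusPartition_union _ J hs, log_plusPartition_union _ J hs,
    Finset.sum_union (disjoint_of_separated h)]
  ring

theorem fieldDefect_translate (κ J : ℝ) {f : Site m → ℝ} (Λ : Finset (Site m)) {v : Site m}
    (hv : height v = 0) (hf : ∀ i, f (i + v) = f i) :
    fieldDefect m κ J f (Λ.map (Equiv.addRight v).toEmbedding) = fieldDefect m κ J f Λ := by
  have key : ∀ g : Site m → ℝ, (∀ i, g (i + v) = g i) →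
      plusPartition (halfGraph m) J (Λ.map (Equiv.addRight v).toEmbedding) g =
        plusPartition (halfGraph m) J Λ g := by
    intro g hg
    have h := plusPartition_map (halfGraph m) (halfGraph m) J Λ (Equiv.addRight v)
      (fun i _ j => halfGraph_adj_add hv i j) g
    rwa [show g ∘ Equiv.addRight v = g from funext hg] at h
  rw [fieldDefect, fieldDefect, key f hf, key (-κ • f) fun i => by simp [hf], Finset.sum_map]
  simp [hf]

theorem fieldDefect_le {κ J : ℝ} (hκ : 0 ≤ κ) {f : Site m → ℝ} {Λ : Finset (Site m)}
    (hf : ∀ i ∈ Λ, 0 ≤ f i) :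
    fieldDefect m κ J f Λ ≤ 2 * (1 + κ) * ∑ i ∈ Λ, f i := by
  have h : Real.exp (-((1 + κ) * ∑ i ∈ Λ, f i)) * plusPartition (halfGraph m) J Λ (-κ • f) ≤
      plusPartition (halfGraph m) J Λ f := by
    simp only [plusPartition, Finset.mul_sum, ← Real.exp_add]
    refine Finset.sum_le_sum fun ω _ => Real.exp_le_exp.2 ?_
    have : ∀ i ∈ Λ, -((1 + κ) * f i) + (-κ • f) i * spin (plusGlue Λ ω) i ≤
        f i * spin (plusGlue Λ ω) i := by
      intro i hi
      have h1 := (abs_le.1 (abs_spin (plusGlue Λ ω) i).le).1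
      have h2 := mul_nonneg (mul_nonneg (add_nonneg zero_le_one hκ) (hf i hi))
        (by linarith : 0 ≤ 1 + spin (plusGlue Λ ω) i)
      simp only [Pi.smul_apply, smul_eq_mul]
      linarith
    have hs := Finset.sum_le_sum this
    rw [Finset.sum_add_distrib, Finset.sum_neg_distrib] at hs
    simp only [action]
    linarith
  have h1 := Real.log_le_log (mul_pos (Real.exp_pos _) (plusPartition_pos _ _ _ _)) h
  rw [Real.log_mul (Real.exp_pos _).ne' (plusPartition_pos _ _ _ _).ne', Real.log_exp] at h1
  rw [fieldDefect]
  linarith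

end SurfaceLimit

/-! ### Limits, monotonicity and concavity of the wall free energy -/

section WallFreeEnergy

variable {m : ℕ}

theorem card_wall_pos {n : ℕ} (hn : 1 ≤ n) : (0 : ℝ) < (wall m n).card := by
  rw [card_wall hn]; positivity

theorem totalField_nonneg {lam : ℝ} {h : ℕ+ → ℝ} (hlam : 0 ≤ lam) (hh : ∀ ℓ, 0 < h ℓ)
    (i : Site m) : 0 ≤ totalField lam (inducedField m h) i :=
  add_nonneg (hh _).le (by split_ifs <;> simp [hlam])

/-- Every horizontal layer of the box has as many sites as the wall, so the field per wall site is a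
partial sum of the series of `h`, plus `lam`. This is how summability enters. -/
theorem sum_totalField_box (lam : ℝ) (h : ℕ+ → ℝ) {n : ℕ} (hn : 1 ≤ n) :
    ∑ i ∈ box m n, totalField lam (inducedField m h) i =
      (wall m n).card * (∑ k ∈ Finset.range n, h k.succPNat + lam) := by
  have hmaps : ∀ i ∈ box m n, (height i).toNat - 1 ∈ Finset.range n := by
    intro i hi
    have := (mem_box.1 hi).1
    rw [Finset.mem_range]
    omega
  have hfiber : ∀ k ∈ Finset.range n, {i ∈ box m n | (height i).toNat - 1 = k} =
      horizontalBox m (k + 1) n := by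
    intro k hk
    rw [Finset.mem_range] at hk
    ext i
    rw [Finset.mem_filter, mem_box, mem_horizontalBox]
    constructor
    · rintro ⟨⟨h1, h2⟩, h3⟩; exact ⟨by omega, h2⟩
    · rintro ⟨h1, h2⟩; exact ⟨⟨by omega, h2⟩, by omega⟩
  have hlam : ∑ k ∈ Finset.range n, (if k = 0 then lam else 0) = lam := by
    rw [Finset.sum_ite_eq' (Finset.range n) 0 fun _ => lam, if_pos (Finset.mem_range.2 hn)]
  conv_rhs => rw [← hlam, ← Finset.sum_add_distrib, Finset.mul_sum]
  rw [← Finset.sum_fiberwise_of_maps_to hmaps]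
  refine Finset.sum_congr rfl fun k hk => ?_
  rw [hfiber k hk, card_wall hn, ← card_horizontalBox (m := m) ((k : ℤ) + 1) n, ← nsmul_eq_mul]
  refine Finset.sum_eq_card_nsmul fun i hi => ?_
  have h1 := (mem_horizontalBox.1 hi).1
  have h2 : (height i).toNat.toPNat' = k.succPNat := by
    rw [h1, show ((k : ℤ) + 1).toNat = k.succ by omega]; rfl
  have h3 : height i = 1 ↔ k = 0 := by omega
  simp only [totalField, inducedField, h2, h3]

theorem summable_succPNat {h : ℕ+ → ℝ} (hs : Summable h) : Summable fun k : ℕ => h k.succPNat :=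
  hs.comp_injective Nat.succPNat_injective

/-- Used with κ = 0 for the field part of F⁺ and with κ = 1 for the difference F⁻ - F⁺. -/
theorem exists_tendsto_field {κ J lam : ℝ} {h : ℕ+ → ℝ} (hκ₀ : 0 ≤ κ) (hκ₁ : κ ≤ 1)
    (hJ : 0 ≤ J) (hlam : 0 ≤ lam) (hh : ∀ ℓ, 0 < h ℓ) (hs : Summable h) :
    ∃ L, Tendsto (fun n =>
      (Real.log (plusPartition (halfGraph m) J (box m n) (totalField lam (inducedField m h))) -
        Real.log (plusPartition (halfGraph m) J (box m n)
          (-κ • totalField lam (inducedField m h)))) / (wall m n).card) atTop (𝓝 L) := by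
  set f := totalField lam (inducedField m h) with hf
  have hf0 : ∀ i, 0 ≤ f i := totalField_nonneg hlam hh
  have htsum : Tendsto (fun n => ∑ k ∈ Finset.range n, h k.succPNat + lam) atTop
      (𝓝 (∑' k : ℕ, h k.succPNat + lam)) :=
    (summable_succPNat hs).hasSum.tendsto_sum_nat.add_const lam
  have hle : ∀ n, ∑ k ∈ Finset.range n, h k.succPNat ≤ ∑' k : ℕ, h k.succPNat := fun n =>
    (summable_succPNat hs).sum_le_tsum _ fun k _ => (hh _).le
  obtain ⟨L, hL⟩ := exists_tendsto_div_card_wall (m := m) (fieldDefect m κ J f)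
    (C := 2 * (1 + κ) * (∑' k : ℕ, h k.succPNat + lam))
    (fun Λ₀ Λ _ h0 => fieldDefect_mono hκ₀ hκ₁ hJ (fun i _ => hf0 i) h0)
    (fun Λ₁ Λ₂ _ _ h0 => fieldDefect_union κ J f h0)
    (fun Λ v _ hv => fieldDefect_translate κ J Λ hv fun i => by
      simp [hf, totalField, inducedField, height_add, hv])
    (fun n => by
      refine (fieldDefect_le hκ₀ fun i _ => hf0 i).trans ?_
      rw [mul_assoc _ (_ + lam)]
      refine mul_le_mul_of_nonneg_left ?_ (by linarith)
      rcases Nat.eq_zero_or_pos n with rfl | hn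
      · have hempty : box m 0 = ∅ := by
          refine Finset.eq_empty_of_forall_notMem fun i hi => ?_
          have := (mem_box.1 hi).1
          push_cast at this
          omega
        rw [hempty, Finset.sum_empty]
        have : 0 ≤ ∑' k : ℕ, h k.succPNat := tsum_nonneg fun k => (hh k.succPNat).le
        positivity
      · rw [hf, sum_totalField_box lam h hn, mul_comm]
        gcongr
        exact hle n)
  refine ⟨_, ((htsum.const_mul (1 + κ)).sub hL).congr' ?_⟩
  filter_upwards [eventually_ge_atTop 1] with n hn
  have hW := (card_wall_pos (m := m) hn).ne'
  rw [fieldDefect, hf, sum_totalField_box lam h hn]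
  field_simp
  ring

theorem exists_tendsto_wall {J : ℝ} (hJ : 0 ≤ J) :
    ∃ L, Tendsto (fun n =>
      (Real.log (plusPartition (latticeGraph m) J (extendedBox m n) 0) -
        2 * Real.log (plusPartition (halfGraph m) J (box m n) 0)) / (wall m n).card)
      atTop (𝓝 L) := by
  obtain ⟨L, hL⟩ := exists_tendsto_div_card_wall (m := m) (wallDefect m J) (C := 2 * J)
    (fun Λ₀ Λ hΛ h => wallDefect_mono hJ hΛ h)
    (fun Λ₁ Λ₂ h₁ h₂ h => wallDefect_union J h₁ h₂ h)
    (fun Λ v _ hv => wallDefect_translate J Λ hv) (wallDefect_box_le hJ)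
  refine ⟨J - L, (hL.const_sub J).congr' ?_⟩
  filter_upwards [eventually_ge_atTop 1] with n hn
  have hW := (card_wall_pos (m := m) hn).ne'
  rw [wallDefect, plusPartition_cutGraph J upper_box, Real.log_pow, extendedBox_eq_double, ← wall]
  push_cast
  field_simp
  ring

/-- The finite-volume wall free energy. -/
def finiteWallFreeEnergy (m : ℕ) (J : ℝ) (f : Site m → ℝ) (n : ℕ) : ℝ :=
  (Real.log (plusPartition (halfGraph m) J (box m n) f) -
    Real.log (plusPartition (halfGraph m) J (box m n) (-f))) / (wall m n).card

/-- Inserting the field-free half-lattice partition function separates the effect of the wall from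
that of the field. -/
theorem finiteSurfaceFreeEnergy_one (J lam : ℝ) (h : ℕ+ → ℝ) (n : ℕ) :
    finiteSurfaceFreeEnergy m 1 J lam h n =
      (Real.log (plusPartition (latticeGraph m) J (extendedBox m n) 0) -
        2 * Real.log (plusPartition (halfGraph m) J (box m n) 0)) / (wall m n).card / 2 -
      (Real.log (plusPartition (halfGraph m) J (box m n) (totalField lam (inducedField m h))) -
        Real.log (plusPartition (halfGraph m) J (box m n) 0)) / (wall m n).card := by
  rw [finiteSurfaceFreeEnergy, semiInfPartition_one, isingPartition_zero,
    Real.log_div (pow_pos (plusPartition_pos _ _ _ _) 2).ne' (plusPartition_pos _ _ _ _).ne',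
    Real.log_pow]
  push_cast
  ring

theorem finiteSurfaceFreeEnergy_neg_one (J lam : ℝ) (h : ℕ+ → ℝ) (n : ℕ) :
    finiteSurfaceFreeEnergy m (-1) J lam h n = finiteSurfaceFreeEnergy m 1 J lam h n +
      finiteWallFreeEnergy m J (totalField lam (inducedField m h)) n := by
  rw [finiteSurfaceFreeEnergy, finiteSurfaceFreeEnergy, semiInfPartition_one,
    semiInfPartition_neg_one, isingPartition_zero, isingPartition_zero,
    Real.log_div (pow_pos (plusPartition_pos _ _ _ _) 2).ne' (plusPartition_pos _ _ _ _).ne',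
    Real.log_div (pow_pos (plusPartition_pos _ _ _ _) 2).ne' (plusPartition_pos _ _ _ _).ne',
    Real.log_pow, Real.log_pow, finiteWallFreeEnergy]
  push_cast
  ring

theorem tendsto_surfaceFreeEnergy {J lam : ℝ} {h : ℕ+ → ℝ} (hJ : 0 ≤ J) (hlam : 0 ≤ lam)
    (hh : ∀ ℓ, 0 < h ℓ) (hs : Summable h) (s : ℤˣ) :
    Tendsto (finiteSurfaceFreeEnergy m s J lam h) atTop (𝓝 (surfaceFreeEnergy m s J lam h)) := by
  refine tendsto_nhds_limUnder ?_
  obtain ⟨a, ha⟩ := exists_tendsto_field (m := m) le_rfl zero_le_one hJ hlam hh hs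
  obtain ⟨b, hb⟩ := exists_tendsto_wall (m := m) hJ
  obtain ⟨c, hc⟩ := exists_tendsto_field (m := m) zero_le_one le_rfl hJ hlam hh hs
  simp only [neg_zero, zero_smul] at ha
  simp only [neg_smul, one_smul] at hc
  have h1 : Tendsto (finiteSurfaceFreeEnergy m 1 J lam h) atTop (𝓝 (b / 2 - a)) :=
    ((hb.div_const 2).sub ha).congr fun n => (finiteSurfaceFreeEnergy_one J lam h n).symm
  rcases Int.units_eq_one_or s with rfl | rfl
  · exact ⟨_, h1⟩
  · exact ⟨_, (h1.add hc).congr fun n => (finiteSurfaceFreeEnergy_neg_one J lam h n).symm⟩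

theorem tendsto_wallFreeEnergy {J lam : ℝ} {h : ℕ+ → ℝ} (hJ : 0 ≤ J) (hlam : 0 ≤ lam)
    (hh : ∀ ℓ, 0 < h ℓ) (hs : Summable h) :
    Tendsto (finiteWallFreeEnergy m J (totalField lam (inducedField m h))) atTop
      (𝓝 (wallFreeEnergy m J lam h)) := by
  refine ((tendsto_surfaceFreeEnergy hJ hlam hh hs (-1)).sub
    (tendsto_surfaceFreeEnergy hJ hlam hh hs 1)).congr fun n => ?_
  rw [finiteSurfaceFreeEnergy_neg_one]
  ring

/-! ### Monotonicity and concavity -/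

theorem finiteWallFreeEnergy_mono {J₁ J₂ : ℝ} (hJ₁ : 0 ≤ J₁) (hJ : J₁ ≤ J₂) {f₁ f₂ : Site m → ℝ}
    (hf₁ : ∀ i, 0 ≤ f₁ i) (hf : ∀ i, f₁ i ≤ f₂ i) (n : ℕ) :
    finiteWallFreeEnergy m J₁ f₁ n ≤ finiteWallFreeEnergy m J₂ f₂ n := by
  have hp : ∀ (J : ℝ) (f : Site m → ℝ), 0 < plusPartition (halfGraph m) J (box m n) f :=
    fun J f => plusPartition_pos _ _ _ _
  have h := Real.log_le_log (mul_pos (hp _ _) (hp _ _))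
    (plusPartition_mul_le (halfGraph m) hJ₁ hJ (box m n) (fun i _ => hf₁ i) fun i _ => hf i)
  rw [Real.log_mul (hp _ _).ne' (hp _ _).ne', Real.log_mul (hp _ _).ne' (hp _ _).ne'] at h
  exact div_le_div_of_nonneg_right (by linarith) (by positivity)

theorem wallFreeEnergy_mono {J₁ J₂ lam : ℝ} {h₁ h₂ : ℕ+ → ℝ} (hJ₁ : 0 ≤ J₁) (hJ : J₁ ≤ J₂)
    (hlam : 0 ≤ lam) (hh₁ : ∀ ℓ, 0 < h₁ ℓ) (hh : ∀ ℓ, h₁ ℓ ≤ h₂ ℓ) (hs₁ : Summable h₁)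
    (hs₂ : Summable h₂) : wallFreeEnergy m J₁ lam h₁ ≤ wallFreeEnergy m J₂ lam h₂ :=
  le_of_tendsto_of_tendsto' (tendsto_wallFreeEnergy hJ₁ hlam hh₁ hs₁)
    (tendsto_wallFreeEnergy (hJ₁.trans hJ) hlam (fun ℓ => (hh₁ ℓ).trans_le (hh ℓ)) hs₂)
    (finiteWallFreeEnergy_mono hJ₁ hJ (totalField_nonneg hlam hh₁)
      fun _ => add_le_add_left (hh _) _)

/-- A negative minimum would be attained at a leftmost point d, interior to the interval. The
midpoint inequality at d ± r forces d - r to be a minimizer too, a contradiction. -/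
theorem nonneg_of_midpoint_le {g : ℝ → ℝ} (hc : Continuous g) (h0 : g 0 = 0) (h1 : g 1 = 0)
    (hmid : ∀ s ∈ Icc (0 : ℝ) 1, ∀ t ∈ Icc (0 : ℝ) 1, g s + g t ≤ 2 * g ((s + t) / 2))
    {u : ℝ} (hu : u ∈ Icc (0 : ℝ) 1) : 0 ≤ g u := by
  obtain ⟨c, hcI, hmin⟩ := isCompact_Icc.exists_isMinOn ⟨u, hu⟩ hc.continuousOn
  by_contra! hneg
  have hμ : g c < 0 := (hmin hu).trans_lt hneg
  obtain ⟨d, ⟨hdI, hd⟩, hleast⟩ := (isCompact_Icc.inter_right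
    (isClosed_singleton.preimage hc : IsClosed (g ⁻¹' {g c}))).exists_isLeast ⟨c, hcI, rfl⟩
  have hd' : g d = g c := hd
  have hd0 : 0 < d := lt_of_le_of_ne hdI.1 fun h => by rw [← h, h0] at hd'; linarith
  have hd1 : d < 1 := lt_of_le_of_ne hdI.2 fun h => by rw [h, h1] at hd'; linarith
  have hr : 0 < min d (1 - d) := lt_min hd0 (by linarith)
  have hr1 := min_le_left d (1 - d)
  have hr2 := min_le_right d (1 - d)
  set r := min d (1 - d)
  have hs : d - r ∈ Icc (0 : ℝ) 1 := ⟨by linarith, by linarith⟩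
  have ht : d + r ∈ Icc (0 : ℝ) 1 := ⟨by linarith, by linarith⟩
  have h2 := hmid _ hs _ ht
  rw [show (d - r + (d + r)) / 2 = d by ring, hd'] at h2
  have h3 : g c ≤ g (d - r) := hmin hs
  have h4 : g c ≤ g (d + r) := hmin ht
  have h5 := hleast ⟨hs, show g (d - r) = g c by linarith⟩
  linarith

/-- On each segment, F minus its chord vanishes at the ends and inherits the midpoint inequality. -/
theorem concaveOn_of_midpoint_le {F : ℝ → ℝ} {S : Set ℝ} (hS : Convex ℝ S) (hc : Continuous F)
    (hmid : ∀ s ∈ S, ∀ t ∈ S, F s + F t ≤ 2 * F ((s + t) / 2)) : ConcaveOn ℝ S F := by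
  refine ⟨hS, fun x hx y hy a b ha hb hab => ?_⟩
  have hmem : ∀ s ∈ Icc (0 : ℝ) 1, (1 - s) * x + s * y ∈ S := fun s hs => by
    simpa using hS hx hy (sub_nonneg.2 hs.2) hs.1 (by ring)
  have h := nonneg_of_midpoint_le
    (g := fun u => F ((1 - u) * x + u * y) - ((1 - u) * F x + u * F y)) (u := b)
    (by fun_prop) (by simp) (by simp) (fun s hs t ht => by
      have h := hmid _ (hmem s hs) _ (hmem t ht)
      rw [show ((1 - s) * x + s * y + ((1 - t) * x + t * y)) / 2 =
        (1 - (s + t) / 2) * x + (s + t) / 2 * y by ring] at h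
      linarith) ⟨hb, by linarith⟩
  have ha' : a = 1 - b := by linarith
  subst ha'
  simpa using h

theorem continuous_log_plusPartition (J : ℝ) (Λ : Finset (Site m)) (g : Site m → ℝ) :
    Continuous fun t : ℝ => Real.log (plusPartition (halfGraph m) J Λ (t • g)) := by
  refine Continuous.log ?_ fun t => (plusPartition_pos _ _ _ _).ne'
  simp only [plusPartition, action, Pi.smul_apply, smul_eq_mul]
  fun_prop

theorem finiteWallFreeEnergy_concaveOn {J : ℝ} (hJ : 0 ≤ J) {g : Site m → ℝ}
    (hg : ∀ i, 0 ≤ g i) (n : ℕ) :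
    ConcaveOn ℝ (Ioi 0) fun t : ℝ => finiteWallFreeEnergy m J (t • g) n := by
  have hp : ∀ f : Site m → ℝ, 0 < plusPartition (halfGraph m) J (box m n) f :=
    fun f => plusPartition_pos _ _ _ _
  refine concaveOn_of_midpoint_le (convex_Ioi 0) ?_ ?_
  · simp only [finiteWallFreeEnergy, ← neg_smul]
    exact ((continuous_log_plusPartition J _ g).sub
      ((continuous_log_plusPartition J _ g).comp continuous_neg)).div_const _
  -- By symmetry s ≤ t, so that the half-difference field ((t - s) / 2) • g is nonnegative.
  · suffices ∀ s t : ℝ, 0 < s → s ≤ t → finiteWallFreeEnergy m J (s • g) n +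
        finiteWallFreeEnergy m J (t • g) n ≤ 2 * finiteWallFreeEnergy m J (((s + t) / 2) • g) n by
      intro s hs t ht
      rcases le_total s t with hst | hst
      · exact this s t hs hst
      · rw [add_comm, add_comm s]
        exact this t s ht hst
    intro s t hs hst
    have h := plusPartition_midpoint_le (halfGraph m) hJ (box m n) (f := ((s + t) / 2) • g)
      (r := ((t - s) / 2) • g) (fun i _ => mul_nonneg (by linarith) (hg i))
      (fun i _ => mul_nonneg (by linarith) (hg i))
    rw [← add_smul, ← sub_smul, show (s + t) / 2 + (t - s) / 2 = t by ring,
      show (s + t) / 2 - (t - s) / 2 = s by ring] at h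
    have h1 := Real.log_le_log
      (mul_pos (mul_pos (hp _) (hp _)) (pow_pos (hp _) 2)) h
    rw [Real.log_mul (mul_pos (hp _) (hp _)).ne' (pow_pos (hp _) 2).ne',
      Real.log_mul (hp _).ne' (hp _).ne', Real.log_pow,
      Real.log_mul (mul_pos (pow_pos (hp _) 2) (hp _)).ne' (hp _).ne',
      Real.log_mul (pow_pos (hp _) 2).ne' (hp _).ne', Real.log_pow] at h1
    push_cast at h1
    simp only [finiteWallFreeEnergy]
    rw [← add_div, ← mul_div_assoc]
    exact div_le_div_of_nonneg_right (by linarith) (by positivity)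

theorem concaveOn_of_tendsto {S : Set ℝ} {F : ℕ → ℝ → ℝ} {f : ℝ → ℝ} (hS : Convex ℝ S)
    (hF : ∀ n, ConcaveOn ℝ S (F n)) (hf : ∀ x ∈ S, Tendsto (fun n => F n x) atTop (𝓝 (f x))) :
    ConcaveOn ℝ S f := by
  refine ⟨hS, fun x hx y hy a b ha hb hab => ?_⟩
  exact le_of_tendsto_of_tendsto' (((hf x hx).const_smul a).add ((hf y hy).const_smul b))
    (hf _ (hS hx hy ha hb hab)) fun n => (hF n).2 hx hy ha hb hab

/-- Without a wall term the total field is linear in t, so concavity along rays applies. -/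
theorem totalField_decayingSequence (δ t : ℝ) :
    totalField 0 (inducedField m (decayingSequence δ t)) =
      t • inducedField m (decayingSequence δ 1) := by
  funext i
  simp [totalField, inducedField, decayingSequence, div_eq_mul_inv]

theorem decayingSequence_pos {t : ℝ} (δ : ℝ) (ht : 0 < t) (ℓ : ℕ+) :
    0 < decayingSequence δ t ℓ :=
  div_pos ht (Real.rpow_pos_of_pos (by exact_mod_cast ℓ.pos) _)

theorem summable_decayingSequence {δ : ℝ} (hδ : 1 < δ) (t : ℝ) :
    Summable (decayingSequence δ t) := by
  have h := ((Real.summable_one_div_nat_rpow.2 hδ).comp_injective PNat.coe_injective).mul_left t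
  refine h.congr fun ℓ => ?_
  simp [decayingSequence, div_eq_mul_inv]

theorem wallFreeEnergy_concaveOn {J δ : ℝ} (hJ : 0 ≤ J) (hδ : 1 < δ) :
    ConcaveOn ℝ (Ioi 0) fun t : ℝ => wallFreeEnergy m J 0 (decayingSequence δ t) := by
  refine concaveOn_of_tendsto
    (F := fun n t => finiteWallFreeEnergy m J (t • inducedField m (decayingSequence δ 1)) n)
    (convex_Ioi 0) (fun n => finiteWallFreeEnergy_concaveOn hJ
      (fun _ => (decayingSequence_pos δ one_pos _).le) n) fun t ht => ?_
  rw [← totalField_decayingSequence]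
  exact tendsto_wallFreeEnergy hJ le_rfl (decayingSequence_pos δ ht)
    (summable_decayingSequence hδ t)

end WallFreeEnergy

end SemiInfIsing

end

theorem mainTheorem7 (m : ℕ) :
    -- the limits defining the two surface free energies exist
    (∀ (J lam : ℝ) (h : ℕ+ → ℝ), 0 < J → 0 ≤ lam → (∀ ℓ, 0 < h ℓ) → Summable h →
      ∀ s : ℤˣ, Tendsto (SemiInfIsing.finiteSurfaceFreeEnergy m s J lam h) atTop
        (𝓝 (SemiInfIsing.surfaceFreeEnergy m s J lam h))) ∧
    -- the wall free energy is non-decreasing in `J`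
    (∀ (lam : ℝ) (h : ℕ+ → ℝ), 0 ≤ lam → (∀ ℓ, 0 < h ℓ) → Summable h →
      MonotoneOn (fun J : ℝ => SemiInfIsing.wallFreeEnergy m J lam h) (Ioi 0)) ∧
    -- the wall free energy is non-decreasing in each `h ℓ`
    (∀ (J lam : ℝ) (h : ℕ+ → ℝ), 0 < J → 0 ≤ lam → (∀ ℓ, 0 < h ℓ) → Summable h →
      ∀ ℓ : ℕ+, MonotoneOn
        (fun t : ℝ => SemiInfIsing.wallFreeEnergy m J lam (Function.update h ℓ t)) (Ioi 0)) ∧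
    -- for `δ > 1`, the wall free energy with field `t / i_d ^ δ` is concave in `t > 0`
    (∀ (J δ : ℝ), 0 < J → 1 < δ →
      ConcaveOn ℝ (Ioi 0)
        (fun t : ℝ => SemiInfIsing.wallFreeEnergy m J 0 (SemiInfIsing.decayingSequence δ t))) := by
  refine ⟨fun J lam h hJ hlam hh hs s => SemiInfIsing.tendsto_surfaceFreeEnergy hJ.le hlam hh hs s,
    fun lam h hlam hh hs J₁ hJ₁ J₂ _ hJ => SemiInfIsing.wallFreeEnergy_mono (le_of_lt hJ₁) hJ hlam
      hh (fun _ => le_rfl) hs hs,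
    fun J lam h hJ hlam hh hs ℓ t₁ ht₁ t₂ _ ht => ?_,
    fun J δ hJ hδ => SemiInfIsing.wallFreeEnergy_concaveOn hJ.le hδ⟩
  refine SemiInfIsing.wallFreeEnergy_mono hJ.le le_rfl hlam (fun k => ?_) (fun k => ?_)
    (hs.update ℓ t₁) (hs.update ℓ t₂)
  · by_cases hk : k = ℓ
    · subst hk; simpa using ht₁
    · simpa [Function.update_of_ne hk] using hh k
  · by_cases hk : k = ℓ
    · subst hk; simpa using ht
    · simp [Function.update_of_ne hk]
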